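/- Let $\mathbf{C}$ be a finitely complete category such that the category $\mathsf{Cat}(\mathbf{C})$ of internal categories and internal functors in $\mathbf{C}$ is finitely complete and finitely cocomplete, and let $\tau_{triv}$ be the trivial Grothendieck topology on $\mathbf{C}$ (the only covering sieve on an object is the maximal one). For a Grothendieck topology $\mathcal{T}$ on $\mathbf{C}$, a morphism of $\mathbf{C}$ is called $\mathcal{T}$-epi if the Yoneda embedding followed by sheafification sends it to an epimorphism of sheaves, and an object $P$ is $\mathcal{T}$-projective if every morphism $P\to R$ lifts through every $\mathcal{T}$-epi $Q\to R$; $\mathbf{C}$ has enough $\mathcal{T}$-projectives if every object admits a $\mathcal{T}$-epi from a $\mathcal{T}$-projective object. For an internal category $B$ let $s,t\colon \mathsf{iso}(B)_1\to B_0$ be the source and target maps of the object of invertible arrows of $B$; for an internal functor $F\colon A\to B$ let $(P_F)_0$ be the pullback of $F_0\colon A_0\to B_0$ along $t\colon\mathsf{iso}(B)_1\to B_0$. The functor $F$ is * fully faithful if the square formed by $F_1\colon A_1\to B_1$, $F_0\times F_0\colon A_0\times A_0\to B_0\times B_0$ and the two maps $(s,t)$ is a pullback; * a $\mathcal{T}$-equivalence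 if it is fully faithful and the composite $(P_F)_0\to \mathsf{iso}(B)_1\xrightarrow{s} B_0$ is $\mathcal{T}$-epi; * a $\mathcal{T}$-fibration if the map $\mathsf{iso}(A)_1\to (P_F)_0$ with components $t$ and $\mathsf{iso}(F)_1$ is $\mathcal{T}$-epi, and an acyclic $\mathcal{T}$-fibration if it is both a $\mathcal{T}$-fibration and a $\mathcal{T}$-equivalence; * a $\mathcal{T}$-cofibration if it has the left lifting property with respect to all acyclic $\mathcal{T}$-fibrations. Then the following hold. 1. A morphism $p$ in $\mathbf{C}$ is $\tau_{triv}$-epi if and only if there exists a morphism $q$ such that $pq=\mathrm{id}$. 2. An internal functor $F$ is an acyclic $\tau_{triv}$-fibration if and only if there exists an internal functor $G$ such that $FG=\mathrm{id}$ and $GF\cong\mathrm{id}$ (internal natural isomorphism). 3. Every object of $\mathbf{C}$ is $\tau_{triv}$-projective, and hence $\mathbf{C}$ has enough $\tau_{triv}$-projectives. Assume moreover that the class of $\tau_{triv}$-equivalences has the 2-out-of-3 property. Then: 4. The $\tau_{triv}$-equivalences, $\tau_{triv}$-fibrations and $\tau_{triv}$-cofibrations are the weak equivalences, fibrations and cofibrations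 of a model structure on $\mathsf{Cat}(\mathbf{C})$, the $\tau_{triv}$-model structure. 5. In it, every object of $\mathsf{Cat}(\mathbf{C})$ is fibrant and cofibrant. 6. Its weak equivalences are precisely the equivalences in the 2-category $\mathsf{Cat}(\mathbf{C})$ of internal categories, internal functors and internal natural transformations. 7. It coincides with Lack's trivial model structure on the underlying category of the 2-category $\mathcal{K}=\mathsf{Cat}(\mathbf{C})$: its weak equivalences (respectively fibrations) are the morphisms $f\colon A\to B$ such that $\mathcal{K}(E,f)\colon\mathcal{K}(E,A)\to\mathcal{K}(E,B)$ is an equivalence of categories (respectively an isofibration) for every $E$, and its cofibrations are the morphisms with the left lifting property with respect to those that are both. -/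

import Mathlib

open CategoryTheory CategoryTheory.Limits

universe w v u

set_option linter.unusedSimpArgs false

noncomputable section

/-! ### Internal categories -/

/-- A category internal to a finitely complete category `C`. A pair of composable arrows is a
point of the pullback of `tgt` along `src`: first an arrow `f`, then an arrow `g` with
`tgt f = src g`; composites are written in diagrammatic order.
Associativity is stated on generalized elements `f, g, h : X ⟶ arr`, which amounts to stating it
on the object of composable triples. -/
structure InternalCategory (C : Type u) [Category.{v} C] [HasFiniteLimits C] where
  /-- the object of objects -/
  obj : C
  /-- the object of arrows -/
  arr : C
  /-- source -/
  src : arr ⟶ obj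
  /-- target -/
  tgt : arr ⟶ obj
  /-- identities -/
  ident : obj ⟶ arr
  /-- composition -/
  mul : pullback tgt src ⟶ arr
  ident_src : ident ≫ src = 𝟙 obj
  ident_tgt : ident ≫ tgt = 𝟙 obj
  mul_src : mul ≫ src = pullback.fst tgt src ≫ src
  mul_tgt : mul ≫ tgt = pullback.snd tgt src ≫ tgt
  ident_mul : pullback.lift (src ≫ ident) (𝟙 arr) (by simp [ident_tgt]) ≫ mul = 𝟙 arr
  mul_ident : pullback.lift (𝟙 arr) (tgt ≫ ident) (by simp [ident_src]) ≫ mul = 𝟙 arr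
  assoc : ∀ {X : C} (f g h : X ⟶ arr) (hfg : f ≫ tgt = g ≫ src) (hgh : g ≫ tgt = h ≫ src),
    pullback.lift (pullback.lift f g hfg ≫ mul) h
        (by rw [Category.assoc, mul_tgt, pullback.lift_snd_assoc, hgh]) ≫ mul =
      pullback.lift f (pullback.lift g h hgh ≫ mul)
        (by rw [Category.assoc, mul_src, pullback.lift_fst_assoc, hfg]) ≫ mul

namespace InternalCategory

variable {C : Type u} [Category.{v} C] [HasFiniteLimits C]

/-- Composition of generalized arrows. -/
def comp (A : InternalCategory C) {X : C} (f g : X ⟶ A.arr) (h : f ≫ A.tgt = g ≫ A.src) :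
    X ⟶ A.arr :=
  pullback.lift f g h ≫ A.mul

variable (A : InternalCategory C) {X Y : C}

theorem comp_congr {f f' g g' : X ⟶ A.arr} (hf : f = f') (hg : g = g')
    (h : f ≫ A.tgt = g ≫ A.src) :
    A.comp f g h = A.comp f' g' (by rw [← hf, ← hg, h]) := by
  subst hf hg; rfl

theorem comp_src (f g : X ⟶ A.arr) (h : f ≫ A.tgt = g ≫ A.src) :
    A.comp f g h ≫ A.src = f ≫ A.src := by
  simp only [comp, Category.assoc, A.mul_src, pullback.lift_fst_assoc]

theorem comp_tgt (f g : X ⟶ A.arr) (h : f ≫ A.tgt = g ≫ A.src) :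
    A.comp f g h ≫ A.tgt = g ≫ A.tgt := by
  simp only [comp, Category.assoc, A.mul_tgt, pullback.lift_snd_assoc]

theorem precomp_comp (k : Y ⟶ X) (f g : X ⟶ A.arr) (h : f ≫ A.tgt = g ≫ A.src) :
    k ≫ A.comp f g h = A.comp (k ≫ f) (k ≫ g) (by simp [h]) := by
  simp only [comp, ← Category.assoc]
  congr 1
  apply pullback.hom_ext <;>
    simp only [Category.assoc, pullback.lift_fst, pullback.lift_snd]

theorem ident_comp (x : X ⟶ A.obj) (f : X ⟶ A.arr) (h : (x ≫ A.ident) ≫ A.tgt = f ≫ A.src) :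
    A.comp (x ≫ A.ident) f h = f := by
  have hx : x = f ≫ A.src := by simpa [A.ident_tgt] using h
  subst hx
  have := congrArg (fun k => f ≫ k) A.ident_mul
  simp only [Category.comp_id] at this
  refine Eq.trans ?_ this
  simp only [comp, ← Category.assoc]
  congr 1
  apply pullback.hom_ext <;>
    simp only [Category.assoc, pullback.lift_fst, pullback.lift_snd, pullback.lift_fst_assoc,
      pullback.lift_snd_assoc, Category.comp_id]

theorem comp_ident (x : X ⟶ A.obj) (f : X ⟶ A.arr) (h : f ≫ A.tgt = (x ≫ A.ident) ≫ A.src) :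
    A.comp f (x ≫ A.ident) h = f := by
  have hx : x = f ≫ A.tgt := by simpa [A.ident_src] using h.symm
  subst hx
  have := congrArg (fun k => f ≫ k) A.mul_ident
  simp only [Category.comp_id] at this
  refine Eq.trans ?_ this
  simp only [comp, ← Category.assoc]
  congr 1
  apply pullback.hom_ext <;>
    simp only [Category.assoc, pullback.lift_fst, pullback.lift_snd, pullback.lift_fst_assoc,
      pullback.lift_snd_assoc, Category.comp_id]

theorem comp_assoc (f g k : X ⟶ A.arr) (hfg : f ≫ A.tgt = g ≫ A.src)
    (hgk : g ≫ A.tgt = k ≫ A.src) :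
    A.comp (A.comp f g hfg) k (by rw [comp_tgt, hgk]) =
      A.comp f (A.comp g k hgk) (by rw [comp_src, hfg]) :=
  A.assoc f g k hfg hgk

end InternalCategory

/-- Internal functors. -/
@[ext]
structure InternalFunctor {C : Type u} [Category.{v} C] [HasFiniteLimits C]
    (A B : InternalCategory C) where
  /-- the map on objects -/
  obj : A.obj ⟶ B.obj
  /-- the map on arrows -/
  arr : A.arr ⟶ B.arr
  arr_src : arr ≫ B.src = A.src ≫ obj
  arr_tgt : arr ≫ B.tgt = A.tgt ≫ obj
  ident_arr : A.ident ≫ arr = obj ≫ B.ident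
  mul_arr : A.mul ≫ arr =
    pullback.lift (pullback.fst A.tgt A.src ≫ arr) (pullback.snd A.tgt A.src ≫ arr)
      (by rw [Category.assoc, Category.assoc, arr_src, arr_tgt, pullback.condition_assoc]) ≫ B.mul

namespace InternalCategory

variable {C : Type u} [Category.{v} C] [HasFiniteLimits C]

theorem comp_arr {A B : InternalCategory C} (F : InternalFunctor A B) {X : C} (f g : X ⟶ A.arr)
    (h : f ≫ A.tgt = g ≫ A.src) :
    A.comp f g h ≫ F.arr = B.comp (f ≫ F.arr) (g ≫ F.arr)
      (by rw [Category.assoc, Category.assoc, F.arr_src, F.arr_tgt, reassoc_of% h]) := by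
  simp only [comp, Category.assoc, F.mul_arr]
  simp only [← Category.assoc]
  congr 1
  apply pullback.hom_ext <;>
    simp only [Category.assoc, pullback.lift_fst, pullback.lift_snd, pullback.lift_fst_assoc,
      pullback.lift_snd_assoc]

/-- The category `Cat(C)` of internal categories and internal functors. -/
instance category : Category.{v} (InternalCategory C) where
  Hom A B := InternalFunctor A B
  id A :=
    { obj := 𝟙 _
      arr := 𝟙 _
      arr_src := by simp
      arr_tgt := by simp
      ident_arr := by simp
      mul_arr := by
        rw [Category.comp_id]
        conv_lhs => rw [← Category.id_comp A.mul]
        congr 1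
        ext <;> simp }
  comp {A B D} F G :=
    { obj := F.obj ≫ G.obj
      arr := F.arr ≫ G.arr
      arr_src := by rw [Category.assoc, G.arr_src, ← Category.assoc, F.arr_src, Category.assoc]
      arr_tgt := by rw [Category.assoc, G.arr_tgt, ← Category.assoc, F.arr_tgt, Category.assoc]
      ident_arr := by
        rw [← Category.assoc, F.ident_arr, Category.assoc, G.ident_arr, Category.assoc]
      mul_arr := by
        rw [← Category.assoc, F.mul_arr]
        refine (comp_arr G _ _ _).trans ?_
        simp only [comp, Category.assoc] }
  id_comp F := InternalFunctor.ext (Category.id_comp _) (Category.id_comp _)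
  comp_id F := InternalFunctor.ext (Category.comp_id _) (Category.comp_id _)
  assoc F G H := InternalFunctor.ext (Category.assoc _ _ _) (Category.assoc _ _ _)

@[simp] theorem id_obj (A : InternalCategory C) : InternalFunctor.obj (𝟙 A) = 𝟙 A.obj := rfl
@[simp] theorem id_arr (A : InternalCategory C) : InternalFunctor.arr (𝟙 A) = 𝟙 A.arr := rfl
@[simp] theorem comp_obj {A B D : InternalCategory C} (F : A ⟶ B) (G : B ⟶ D) :
    InternalFunctor.obj (F ≫ G) = F.obj ≫ G.obj := rfl
@[simp] theorem comp_arr' {A B D : InternalCategory C} (F : A ⟶ B) (G : B ⟶ D) :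
    InternalFunctor.arr (F ≫ G) = F.arr ≫ G.arr := rfl

end InternalCategory

/-! ### Internal natural transformations and the 2-category `Cat(C)` -/

/-- Internal natural transformations `F ⟹ G`: a map `A₀ ⟶ B₁` assigning to an object `a` an arrow
`F a ⟶ G a`, naturally in `a`. -/
@[ext]
structure InternalNatTrans {C : Type u} [Category.{v} C] [HasFiniteLimits C]
    {A B : InternalCategory C} (F G : InternalFunctor A B) where
  /-- the components -/
  app : A.obj ⟶ B.arr
  app_src : app ≫ B.src = F.obj
  app_tgt : app ≫ B.tgt = G.obj
  naturality :
    B.comp F.arr (A.tgt ≫ app) (by rw [Category.assoc, app_src, F.arr_tgt]) =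
      B.comp (A.src ≫ app) G.arr (by rw [Category.assoc, app_tgt, G.arr_src])

namespace InternalCategory

variable {C : Type u} [Category.{v} C] [HasFiniteLimits C]

theorem naturality_elt {A B : InternalCategory C} {F G : InternalFunctor A B}
    (α : InternalNatTrans F G) {X : C} (x : X ⟶ A.arr)
    (h₁ : (x ≫ F.arr) ≫ B.tgt = (x ≫ A.tgt ≫ α.app) ≫ B.src)
    (h₂ : (x ≫ A.src ≫ α.app) ≫ B.tgt = (x ≫ G.arr) ≫ B.src) :
    B.comp (x ≫ F.arr) (x ≫ A.tgt ≫ α.app) h₁ = B.comp (x ≫ A.src ≫ α.app) (x ≫ G.arr) h₂ := by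
  have := congrArg (fun k => x ≫ k) α.naturality
  simpa only [precomp_comp] using this

/-- The category `Cat(C)(A, B)` of internal functors and internal natural transformations. -/
instance homCategory (A B : InternalCategory C) : Category.{v} (A ⟶ B) where
  Hom F G := InternalNatTrans F G
  id F :=
    { app := F.obj ≫ B.ident
      app_src := by rw [Category.assoc, B.ident_src, Category.comp_id]
      app_tgt := by rw [Category.assoc, B.ident_tgt, Category.comp_id]
      naturality := by
        rw [B.comp_congr rfl (Category.assoc _ _ _).symm, comp_ident,
          B.comp_congr (Category.assoc _ _ _).symm rfl, ident_comp] }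
  comp {F G H} α β :=
    { app := B.comp α.app β.app (by rw [α.app_tgt, β.app_src])
      app_src := by rw [comp_src, α.app_src]
      app_tgt := by rw [comp_tgt, β.app_tgt]
      naturality := by
        have e₁ : F.arr ≫ B.tgt = (A.tgt ≫ α.app) ≫ B.src := by
          rw [Category.assoc, α.app_src, F.arr_tgt]
        have e₂ : (A.tgt ≫ α.app) ≫ B.tgt = (A.tgt ≫ β.app) ≫ B.src := by
          rw [Category.assoc, Category.assoc, α.app_tgt, β.app_src]
        have e₃ : (A.src ≫ α.app) ≫ B.tgt = G.arr ≫ B.src := by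
          rw [Category.assoc, α.app_tgt, G.arr_src]
        have e₄ : G.arr ≫ B.tgt = (A.tgt ≫ β.app) ≫ B.src := by
          rw [Category.assoc, β.app_src, G.arr_tgt]
        have e₅ : (A.src ≫ α.app) ≫ B.tgt = (A.src ≫ β.app) ≫ B.src := by
          rw [Category.assoc, Category.assoc, α.app_tgt, β.app_src]
        have e₆ : (A.src ≫ β.app) ≫ B.tgt = H.arr ≫ B.src := by
          rw [Category.assoc, β.app_tgt, H.arr_src]
        rw [B.comp_congr rfl (B.precomp_comp A.tgt α.app β.app _),
          B.comp_congr (B.precomp_comp A.src α.app β.app _) rfl,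
          ← B.comp_assoc F.arr (A.tgt ≫ α.app) (A.tgt ≫ β.app) e₁ e₂,
          B.comp_congr α.naturality rfl,
          B.comp_assoc (A.src ≫ α.app) G.arr (A.tgt ≫ β.app) e₃ e₄,
          B.comp_congr rfl β.naturality,
          B.comp_assoc (A.src ≫ α.app) (A.src ≫ β.app) H.arr e₅ e₆] }
  id_comp α := InternalNatTrans.ext (ident_comp _ _ _ _)
  comp_id α := InternalNatTrans.ext (comp_ident _ _ _ _)
  assoc α β γ := InternalNatTrans.ext (comp_assoc _ _ _ _ _ _)

theorem hom₂_ext {A B : InternalCategory C} {F G : A ⟶ B} {α β : F ⟶ G}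
    (h : InternalNatTrans.app α = InternalNatTrans.app β) : α = β :=
  InternalNatTrans.ext h

theorem id_app {A B : InternalCategory C} (F : A ⟶ B) :
    InternalNatTrans.app (𝟙 F) = F.obj ≫ B.ident := rfl

theorem comp_app {A B : InternalCategory C} {F G H : A ⟶ B} (α : F ⟶ G) (β : G ⟶ H) :
    InternalNatTrans.app (α ≫ β) =
      B.comp α.app β.app (α.app_tgt.trans β.app_src.symm) := rfl

theorem eqToHom_app {A B : InternalCategory C} {F G : A ⟶ B} (h : F = G) :
    InternalNatTrans.app (eqToHom h) = F.obj ≫ B.ident := by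
  subst h; rfl

theorem eqToHom_comp_app {A B : InternalCategory C} {F G H : A ⟶ B} (h : F = G) (α : G ⟶ H) :
    InternalNatTrans.app (eqToHom h ≫ α) = α.app := by
  subst h; simp

theorem comp_eqToHom_app {A B : InternalCategory C} {F G H : A ⟶ B} (α : F ⟶ G) (h : G = H) :
    InternalNatTrans.app (α ≫ eqToHom h) = α.app := by
  subst h; simp

/-- Left whiskering, with components `a ↦ η (F a)`. -/
def whiskerLeft {A B D : InternalCategory C} (F : A ⟶ B) {G H : B ⟶ D} (η : G ⟶ H) :
    F ≫ G ⟶ F ≫ H :=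
  InternalNatTrans.mk (F := F ≫ G) (G := F ≫ H) (F.obj ≫ η.app)
    (by rw [Category.assoc, η.app_src]; rfl)
    (by rw [Category.assoc, η.app_tgt]; rfl)
    (by
      have e₁ : A.tgt ≫ F.obj ≫ η.app = F.arr ≫ B.tgt ≫ η.app := by
        rw [← Category.assoc, ← F.arr_tgt, Category.assoc]
      have e₂ : A.src ≫ F.obj ≫ η.app = F.arr ≫ B.src ≫ η.app := by
        rw [← Category.assoc, ← F.arr_src, Category.assoc]
      rw [D.comp_congr rfl e₁, D.comp_congr e₂ rfl]
      exact naturality_elt η F.arr _ _)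

/-- Right whiskering, with components `a ↦ H (η a)`. -/
def whiskerRight {A B D : InternalCategory C} {F G : A ⟶ B} (η : F ⟶ G) (H : B ⟶ D) :
    F ≫ H ⟶ G ≫ H :=
  InternalNatTrans.mk (F := F ≫ H) (G := G ≫ H) (η.app ≫ H.arr)
    (by rw [Category.assoc, H.arr_src, ← Category.assoc, η.app_src]; rfl)
    (by rw [Category.assoc, H.arr_tgt, ← Category.assoc, η.app_tgt]; rfl)
    (by
      have := congrArg (fun k => k ≫ H.arr) η.naturality
      simp only [comp_arr] at this
      rw [D.comp_congr rfl (Category.assoc _ _ _).symm,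
        D.comp_congr (Category.assoc _ _ _).symm rfl]
      exact this)

theorem whiskerLeft_app {A B D : InternalCategory C} (F : A ⟶ B) {G H : B ⟶ D} (η : G ⟶ H) :
    InternalNatTrans.app (whiskerLeft F η) = F.obj ≫ η.app := rfl

theorem whiskerRight_app {A B D : InternalCategory C} {F G : A ⟶ B} (η : F ⟶ G) (H : B ⟶ D) :
    InternalNatTrans.app (whiskerRight η H) = η.app ≫ H.arr := rfl

theorem whiskerRight_eqToHom {A B D : InternalCategory C} {F G : A ⟶ B} (h : F = G) (H : B ⟶ D) :
    whiskerRight (eqToHom h) H = eqToHom (congrArg (fun k => k ≫ H) h) := by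
  subst h
  exact hom₂_ext (by
    rw [eqToHom_app, whiskerRight_app, eqToHom_app, comp_obj, Category.assoc, Category.assoc,
      H.ident_arr])

/-- The 2-category `Cat(C)` of internal categories, internal functors and internal natural
transformations. -/
instance bicategory : Bicategory.{v, v} (InternalCategory C) where
  homCategory := homCategory
  whiskerLeft F _ _ η := whiskerLeft F η
  whiskerRight η H := whiskerRight η H
  associator F G H := eqToIso (Category.assoc F G H)
  leftUnitor F := eqToIso (Category.id_comp F)
  rightUnitor F := eqToIso (Category.comp_id F)
  whiskerLeft_id F G := hom₂_ext (by
    rw [whiskerLeft_app, id_app, id_app, comp_obj, Category.assoc])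
  whiskerLeft_comp F _ _ _ η θ := hom₂_ext (by
    rw [whiskerLeft_app, comp_app, comp_app, precomp_comp]; rfl)
  id_whiskerLeft η := hom₂_ext (by
    rw [eqToIso.hom, eqToIso.inv, eqToHom_comp_app, comp_eqToHom_app, whiskerLeft_app, id_obj,
      Category.id_comp])
  comp_whiskerLeft F G _ _ η := hom₂_ext (by
    rw [eqToIso.hom, eqToIso.inv, eqToHom_comp_app, comp_eqToHom_app]
    simp only [whiskerLeft_app, comp_obj, Category.assoc])
  id_whiskerRight F G := hom₂_ext (by
    rw [whiskerRight_app, id_app, id_app, comp_obj, Category.assoc, Category.assoc, G.ident_arr])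
  comp_whiskerRight η θ H := hom₂_ext (by
    rw [whiskerRight_app, comp_app, comp_app, comp_arr]; rfl)
  whiskerRight_id η := hom₂_ext (by
    rw [eqToIso.hom, eqToIso.inv, eqToHom_comp_app, comp_eqToHom_app, whiskerRight_app, id_arr,
      Category.comp_id])
  whiskerRight_comp η G H := hom₂_ext (by
    rw [eqToIso.hom, eqToIso.inv, eqToHom_comp_app, comp_eqToHom_app]
    simp only [whiskerRight_app, comp_arr', Category.assoc])
  whisker_assoc F _ _ η H := hom₂_ext (by
    rw [eqToIso.hom, eqToIso.inv, eqToHom_comp_app, comp_eqToHom_app]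
    simp only [whiskerRight_app, whiskerLeft_app, Category.assoc])
  whisker_exchange {A B D F G H I} η θ := hom₂_ext (by
    rw [comp_app, comp_app]
    simp only [whiskerRight_app, whiskerLeft_app]
    have e₁ : F.obj ≫ θ.app = η.app ≫ B.src ≫ θ.app := by rw [← Category.assoc, η.app_src]
    have e₂ : G.obj ≫ θ.app = η.app ≫ B.tgt ≫ θ.app := by rw [← Category.assoc, η.app_tgt]
    rw [D.comp_congr e₁ rfl, D.comp_congr rfl e₂]
    exact (naturality_elt θ η.app _ _).symm)
  pentagon F G H I := hom₂_ext (by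
    have h : whiskerRight (eqToHom (Category.assoc F G H)) I =
        eqToHom (congrArg (fun k => k ≫ I) (Category.assoc F G H)) := whiskerRight_eqToHom _ _
    simp only [eqToIso.hom, h, eqToHom_comp_app, eqToHom_app, whiskerLeft_app, comp_obj,
      Category.assoc])
  triangle F G := hom₂_ext (by
    simp only [eqToIso.hom, eqToHom_comp_app, eqToHom_app, whiskerLeft_app, whiskerRight_app,
      Category.assoc, Category.id_comp, Category.comp_id, G.ident_arr])

instance strict : Bicategory.Strict (InternalCategory C) where
  id_comp := Category.id_comp
  comp_id := Category.comp_id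
  assoc := Category.assoc
  leftUnitor_eqToIso _ := rfl
  rightUnitor_eqToIso _ := rfl
  associator_eqToIso _ _ _ := rfl

/-! ### The object of invertible arrows -/

/-- The generalized arrows `f` and `g` are mutually inverse. -/
structure IsInverse (A : InternalCategory C) {X : C} (f g : X ⟶ A.arr) : Prop where
  tgt_src : f ≫ A.tgt = g ≫ A.src
  src_tgt : g ≫ A.tgt = f ≫ A.src
  comp_eq : A.comp f g tgt_src = (f ≫ A.src) ≫ A.ident
  comp_eq' : A.comp g f src_tgt = (f ≫ A.tgt) ≫ A.ident

/-- The object of pairs of arrows `f : a ⟶ b`, `g : b ⟶ a`. -/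
def antiparallel (A : InternalCategory C) : C :=
  pullback (prod.lift A.src A.tgt) (prod.lift A.tgt A.src)

/-- The first arrow of such a pair. -/
def antiparallelFst (A : InternalCategory C) : A.antiparallel ⟶ A.arr := pullback.fst _ _

/-- The second arrow of such a pair. -/
def antiparallelSnd (A : InternalCategory C) : A.antiparallel ⟶ A.arr := pullback.snd _ _

theorem antiparallel_src_tgt (A : InternalCategory C) :
    A.antiparallelSnd ≫ A.tgt = A.antiparallelFst ≫ A.src := by
  have h : A.antiparallelFst ≫ prod.lift A.src A.tgt =
      A.antiparallelSnd ≫ prod.lift A.tgt A.src := pullback.condition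
  have h' := congrArg (fun k => k ≫ prod.fst) h
  simp only [Category.assoc, prod.lift_fst] at h'
  exact h'.symm

theorem antiparallel_tgt_src (A : InternalCategory C) :
    A.antiparallelFst ≫ A.tgt = A.antiparallelSnd ≫ A.src := by
  have h : A.antiparallelFst ≫ prod.lift A.src A.tgt =
      A.antiparallelSnd ≫ prod.lift A.tgt A.src := pullback.condition
  have h' := congrArg (fun k => k ≫ prod.snd) h
  simpa only [Category.assoc, prod.lift_snd] using h'

/-- The composites `(f ≫ g, g ≫ f)` of such a pair. -/
def antiparallelComp (A : InternalCategory C) : A.antiparallel ⟶ A.arr ⨯ A.arr :=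
  prod.lift (A.comp A.antiparallelFst A.antiparallelSnd A.antiparallel_tgt_src)
    (A.comp A.antiparallelSnd A.antiparallelFst A.antiparallel_src_tgt)

/-- The identities `(𝟙 a, 𝟙 b)` of such a pair. -/
def antiparallelIdent (A : InternalCategory C) : A.antiparallel ⟶ A.arr ⨯ A.arr :=
  prod.lift ((A.antiparallelFst ≫ A.src) ≫ A.ident) ((A.antiparallelFst ≫ A.tgt) ≫ A.ident)

/-- The object `iso(A)₁` of invertible arrows of `A`, constructed as the object of pairs of
mutually inverse arrows. -/
def isoArr (A : InternalCategory C) : C := equalizer A.antiparallelComp A.antiparallelIdent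

/-- The embedding of `iso(A)₁` into the object of pairs of antiparallel arrows. -/
def isoEmb (A : InternalCategory C) : A.isoArr ⟶ A.antiparallel := equalizer.ι _ _

/-- The inclusion of the object of invertible arrows into the object of arrows. -/
def isoι (A : InternalCategory C) : A.isoArr ⟶ A.arr := A.isoEmb ≫ A.antiparallelFst

/-- The inverse of the generic invertible arrow. -/
def isoInv (A : InternalCategory C) : A.isoArr ⟶ A.arr := A.isoEmb ≫ A.antiparallelSnd

/-- The source map `s : iso(A)₁ ⟶ A₀`. -/
def isoSrc (A : InternalCategory C) : A.isoArr ⟶ A.obj := A.isoι ≫ A.src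

/-- The target map `t : iso(A)₁ ⟶ A₀`. -/
def isoTgt (A : InternalCategory C) : A.isoArr ⟶ A.obj := A.isoι ≫ A.tgt

theorem IsInverse.precomp {A : InternalCategory C} {X Y : C} {f g : X ⟶ A.arr}
    (h : A.IsInverse f g) (k : Y ⟶ X) : A.IsInverse (k ≫ f) (k ≫ g) where
  tgt_src := by simp [h.tgt_src]
  src_tgt := by simp [h.src_tgt]
  comp_eq := by rw [← precomp_comp A k f g h.tgt_src, h.comp_eq]; simp
  comp_eq' := by rw [← precomp_comp A k g f h.src_tgt, h.comp_eq']; simp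

theorem IsInverse.map {A B : InternalCategory C} (F : A ⟶ B) {X : C} {f g : X ⟶ A.arr}
    (h : A.IsInverse f g) : B.IsInverse (f ≫ F.arr) (g ≫ F.arr) where
  tgt_src := by
    rw [Category.assoc, Category.assoc, F.arr_tgt, F.arr_src, ← Category.assoc, h.tgt_src,
      Category.assoc]
  src_tgt := by
    rw [Category.assoc, Category.assoc, F.arr_tgt, F.arr_src, ← Category.assoc, h.src_tgt,
      Category.assoc]
  comp_eq := by
    rw [← comp_arr F f g h.tgt_src, h.comp_eq]
    simp only [Category.assoc, F.ident_arr]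
    rw [← Category.assoc F.arr, F.arr_src, Category.assoc]
  comp_eq' := by
    rw [← comp_arr F g f h.src_tgt, h.comp_eq']
    simp only [Category.assoc, F.ident_arr]
    rw [← Category.assoc F.arr, F.arr_tgt, Category.assoc]

theorem isInverse_iso (A : InternalCategory C) : A.IsInverse A.isoι A.isoInv := by
  have h : A.isoEmb ≫ A.antiparallelComp = A.isoEmb ≫ A.antiparallelIdent := equalizer.condition _ _
  have h₁ := congrArg (fun k => k ≫ prod.fst) h
  have h₂ := congrArg (fun k => k ≫ prod.snd) h
  simp only [antiparallelComp, antiparallelIdent, Category.assoc, prod.lift_fst,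
    prod.lift_snd] at h₁ h₂
  refine ⟨?_, ?_, ?_, ?_⟩
  · rw [isoι, isoInv, Category.assoc, Category.assoc, antiparallel_tgt_src]
  · rw [isoι, isoInv, Category.assoc, Category.assoc, antiparallel_src_tgt]
  · simp only [isoι, isoInv, Category.assoc]
    rw [← h₁, precomp_comp]
  · simp only [isoι, isoInv, Category.assoc]
    rw [← h₂, precomp_comp]

/-- The map into `iso(A)₁` given by a pair of mutually inverse generalized arrows. -/
def isoLift (A : InternalCategory C) {X : C} (f g : X ⟶ A.arr) (h : A.IsInverse f g) :
    X ⟶ A.isoArr :=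
  have hp : f ≫ prod.lift A.src A.tgt = g ≫ prod.lift A.tgt A.src := by
    apply Limits.prod.hom_ext
    · simp only [Category.assoc, prod.lift_fst, h.src_tgt]
    · simp only [Category.assoc, prod.lift_snd, h.tgt_src]
  let l : X ⟶ A.antiparallel := pullback.lift f g hp
  equalizer.lift l (by
    have e₁ : l ≫ A.antiparallelFst = f := pullback.lift_fst _ _ _
    have e₂ : l ≫ A.antiparallelSnd = g := pullback.lift_snd _ _ _
    apply Limits.prod.hom_ext
    · simp only [antiparallelComp, antiparallelIdent, Category.assoc, prod.lift_fst]
      rw [precomp_comp, A.comp_congr e₁ e₂, h.comp_eq, reassoc_of% e₁, Category.assoc]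
    · simp only [antiparallelComp, antiparallelIdent, Category.assoc, prod.lift_snd]
      rw [precomp_comp, A.comp_congr e₂ e₁, h.comp_eq', reassoc_of% e₁, Category.assoc])

theorem isoLift_ι (A : InternalCategory C) {X : C} (f g : X ⟶ A.arr) (h : A.IsInverse f g) :
    A.isoLift f g h ≫ A.isoι = f := by
  have hp : f ≫ prod.lift A.src A.tgt = g ≫ prod.lift A.tgt A.src := by
    apply Limits.prod.hom_ext
    · simp only [Category.assoc, prod.lift_fst, h.src_tgt]
    · simp only [Category.assoc, prod.lift_snd, h.tgt_src]
  have e : A.isoLift f g h ≫ A.isoEmb = pullback.lift f g hp := equalizer.lift_ι _ _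
  rw [isoι, reassoc_of% e]
  exact pullback.lift_fst _ _ _

theorem IsInverse.unique {A : InternalCategory C} {X : C} {f g g' : X ⟶ A.arr}
    (h : A.IsInverse f g) (h' : A.IsInverse f g') : g = g' := by
  have key := A.comp_assoc g f g' h.src_tgt h'.tgt_src
  rw [A.comp_congr h.comp_eq' rfl, A.comp_congr rfl h'.comp_eq, ident_comp, comp_ident] at key
  exact key.symm

theorem iso_hom_ext (A : InternalCategory C) {X : C} {k l : X ⟶ A.isoArr}
    (h : k ≫ A.isoι = l ≫ A.isoι) : k = l := by
  have hk := A.isInverse_iso.precomp k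
  have hl := A.isInverse_iso.precomp l
  rw [h] at hk
  have h' : k ≫ A.isoInv = l ≫ A.isoInv := hk.unique hl
  have e : k ≫ A.isoEmb = l ≫ A.isoEmb := by
    apply pullback.hom_ext
    · exact (Category.assoc _ _ _).trans (h.trans (Category.assoc _ _ _).symm)
    · exact (Category.assoc _ _ _).trans (h'.trans (Category.assoc _ _ _).symm)
  exact equalizer.hom_ext e

/-- `iso(A)₁` represents the invertible generalized arrows of `A`. -/
theorem exists_isInverse_iff (A : InternalCategory C) {X : C} (f : X ⟶ A.arr) :
    (∃ g, A.IsInverse f g) ↔ ∃! k : X ⟶ A.isoArr, k ≫ A.isoι = f := by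
  constructor
  · rintro ⟨g, h⟩
    refine ⟨A.isoLift f g h, A.isoLift_ι f g h, fun k hk => A.iso_hom_ext ?_⟩
    rw [hk, isoLift_ι]
  · rintro ⟨k, rfl, -⟩
    exact ⟨_, A.isInverse_iso.precomp k⟩

/-- The map `iso(F)₁ : iso(A)₁ ⟶ iso(B)₁` induced by an internal functor. -/
def isoMap {A B : InternalCategory C} (F : A ⟶ B) : A.isoArr ⟶ B.isoArr :=
  B.isoLift (A.isoι ≫ F.arr) (A.isoInv ≫ F.arr) (A.isInverse_iso.map F)

theorem isoTgt_obj {A B : InternalCategory C} (F : A ⟶ B) :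
    A.isoTgt ≫ F.obj = isoMap F ≫ B.isoTgt := by
  simp only [isoTgt, isoMap]
  rw [reassoc_of% isoLift_ι, Category.assoc, Category.assoc, F.arr_tgt]

/-! ### Classes of internal functors defined by a Grothendieck topology on `C` -/

/-- The object `(P_F)₀` of the mapping path object of `F`: pairs of an object `a` of `A` and an
isomorphism `b ≅ F a` of `B`. -/
def mappingPath {A B : InternalCategory C} (F : A ⟶ B) : C := pullback F.obj B.isoTgt

/-- The map `(P_F)₀ ⟶ B₀` sending `(a, b ≅ F a)` to `b`. -/
def mappingPathSrc {A B : InternalCategory C} (F : A ⟶ B) : mappingPath F ⟶ B.obj :=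
  pullback.snd F.obj B.isoTgt ≫ B.isoSrc

/-- The map `(r_F)₀ : iso(A)₁ ⟶ (P_F)₀` sending `a' ≅ a` to `(a, F a' ≅ F a)`. -/
def toMappingPath {A B : InternalCategory C} (F : A ⟶ B) : A.isoArr ⟶ mappingPath F :=
  pullback.lift A.isoTgt (isoMap F) (isoTgt_obj F)

end InternalCategory

open InternalCategory

section Topology

variable {C : Type u} [Category.{v} C]

/-- `T`-epimorphisms: morphisms of `C` sent to an epimorphism of sheaves by the Yoneda embedding
followed by sheafification. As `C` need not be small, the sheaves take values in the universe
`max u v`, which contains both the objects and the morphisms of `C`. -/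
def topologyEpis (T : GrothendieckTopology C) : MorphismProperty C := fun _ _ p =>
  Epi (((uliftYoneda.{u} : C ⥤ Cᵒᵖ ⥤ Type (max u v)) ⋙
    presheafToSheaf T (Type (max u v))).map p)

/-- `T`-projective objects of `C`. -/
def IsTopologyProjective (T : GrothendieckTopology C) (P : C) : Prop :=
  ∀ ⦃Q R : C⦄ (G : Q ⟶ R), topologyEpis T G → ∀ H : P ⟶ R, ∃ F : P ⟶ Q, F ≫ G = H

/-- `C` has enough `T`-projectives. -/
def EnoughTopologyProjectives (T : GrothendieckTopology C) : Prop :=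
  ∀ X : C, ∃ (P : C) (p : P ⟶ X), IsTopologyProjective T P ∧ topologyEpis T p

variable [HasFiniteLimits C]

/-- Fully faithful internal functors. -/
def internalFullyFaithful : MorphismProperty (InternalCategory C) := fun A B F =>
  IsPullback F.arr (prod.lift A.src A.tgt) (prod.lift B.src B.tgt) (prod.map F.obj F.obj)

/-- The class `we(T)` of `T`-equivalences: fully faithful and essentially `T`-surjective
internal functors. -/
def topologyEquivalences (T : GrothendieckTopology C) : MorphismProperty (InternalCategory C) :=
  fun _ _ F => internalFullyFaithful F ∧ topologyEpis T (mappingPathSrc F)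

/-- The class `fib(T)` of `T`-fibrations. -/
def topologyFibrations (T : GrothendieckTopology C) : MorphismProperty (InternalCategory C) :=
  fun _ _ F => topologyEpis T (toMappingPath F)

/-- The class of acyclic `T`-fibrations. -/
def acyclicTopologyFibrations (T : GrothendieckTopology C) :
    MorphismProperty (InternalCategory C) :=
  topologyFibrations T ⊓ topologyEquivalences T

/-- The class `cof(T)` of `T`-cofibrations. -/
def topologyCofibrations (T : GrothendieckTopology C) : MorphismProperty (InternalCategory C) :=
  (acyclicTopologyFibrations T).llp

end Topology

/-! ### The trivial model structure on the underlying category of a 2-category -/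

/-- Isofibrations of categories, i.e. the fibrations of the categorical model structure on the
category of categories, whose weak equivalences are the equivalences of categories. -/
def IsIsofibration {D E : Type*} [Category* D] [Category* E] (F : D ⥤ E) : Prop :=
  ∀ (d : D) (e : E) (β : e ≅ F.obj d),
    ∃ (d' : D) (α : d' ≅ d) (h : F.obj d' = e), F.map α.hom = eqToHom h ≫ β.hom

section TwoCategory

variable (K : Type u) [Bicategory.{w, v} K] [Bicategory.Strict K]

/-- Weak equivalences of the trivial model structure: the morphisms `f : A ⟶ B` such that
`K(E, f) : K(E, A) ⥤ K(E, B)` is an equivalence of categories for all `E`. -/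
def trivialModelWeakEquivalences : MorphismProperty K := fun _ _ f =>
  ∀ E : K, (Bicategory.postcomp E f).IsEquivalence

/-- Fibrations of the trivial model structure: the morphisms `f : A ⟶ B` such that
`K(E, f) : K(E, A) ⥤ K(E, B)` is an isofibration for all `E`. -/
def trivialModelFibrations : MorphismProperty K := fun _ _ f =>
  ∀ E : K, IsIsofibration (Bicategory.postcomp E f)

/-- Cofibrations of the trivial model structure: the morphisms with the left lifting property with
respect to the morphisms that are both fibrations and weak equivalences. -/
def trivialModelCofibrations : MorphismProperty K :=
  (trivialModelFibrations K ⊓ trivialModelWeakEquivalences K).llp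

variable {K}

/-- `f : A ⟶ B` is an equivalence in the 2-category `K`. -/
def IsTwoEquivalence {A B : K} (f : A ⟶ B) : Prop :=
  ∃ g : B ⟶ A, Nonempty (f ≫ g ≅ 𝟙 A) ∧ Nonempty (g ≫ f ≅ 𝟙 B)

end TwoCategory

end

-- For the trivial topology every presheaf is a sheaf, so a `T`-epi is a pointwise surjection of
-- representables, that is, a split epimorphism (`topologyEpis_trivial_iff`). Each surjectivity
-- condition thus becomes a section, and one can argue with generalized elements as for small
-- categories with choice.
--
-- Two devices carry the argument. Conjugation (`transport`) replaces a functor by an isomorphic one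
-- along any family of invertible components, and those components determine the result
-- (`functor_eq_of_iso_app_eq`). Full faithfulness lifts a functor as soon as its object part lifts,
-- and reflects natural isomorphisms (`exists_functor_lift`, `exists_iso_lift`). They show that
-- equivalences for the trivial topology have pseudo-inverses, that acyclic fibrations have strict
-- sections which are pseudo-inverses, and that fibrations are representably isofibrations. The
-- comparisons with representable notions are reversed by testing on discrete categories, functors
-- out of which are generalized objects.
--
-- Both factorizations only change the object of objects. Pulling the arrows of `B` back along `A₀ ⨿
-- B₀ ⟶ B₀` yields a cofibration followed by an acyclic fibration. Pulling the arrows of `A` back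
-- along `A₀ ⨿ (P_F)₀ ⟶ A₀`, then conjugating the composite with `F`, yields `PathFactorization`: an
-- acyclic cofibration lifting against all fibrations, followed by a fibration. The first factors
-- are coproduct injections on objects, hence cofibrations; the coproducts needed in `C` come from
-- those of `Cat(C)` (`hasBinaryCoproducts`). Retract arguments then give the two weak factorization
-- systems.

namespace InternalCategory

variable {C : Type u} [Category.{v} C] [HasFiniteLimits C]

/-! ### Calculus of generalized arrows -/

theorem comp_assoc_elt (A : InternalCategory C) {X : C} (f g k : X ⟶ A.arr)
    (h₁ : f ≫ A.tgt = g ≫ A.src) (h₂ : A.comp f g h₁ ≫ A.tgt = k ≫ A.src) :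
    A.comp (A.comp f g h₁) k h₂ =
      A.comp f (A.comp g k (by rw [← h₂, comp_tgt])) (by rw [comp_src, h₁]) :=
  A.comp_assoc f g k h₁ (by rw [← h₂, comp_tgt])

theorem mul_arr {A B : InternalCategory C} (F : A ⟶ B) :
    A.mul ≫ F.arr = B.comp (pullback.fst A.tgt A.src ≫ F.arr) (pullback.snd A.tgt A.src ≫ F.arr)
      (by rw [Category.assoc, Category.assoc, F.arr_src, F.arr_tgt, pullback.condition_assoc]) :=
  F.mul_arr

namespace IsInverse

variable {A : InternalCategory C} {X : C} {f g : X ⟶ A.arr}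

theorem symm (h : A.IsInverse f g) : A.IsInverse g f where
  tgt_src := h.src_tgt
  src_tgt := h.tgt_src
  comp_eq := by rw [h.comp_eq', h.tgt_src]
  comp_eq' := by rw [h.comp_eq, h.src_tgt]

theorem comp_comp (h : A.IsInverse f g) (k : X ⟶ A.arr) (h₁ : g ≫ A.tgt = k ≫ A.src)
    (h₂ : f ≫ A.tgt = A.comp g k h₁ ≫ A.src) : A.comp f (A.comp g k h₁) h₂ = k := by
  rw [← A.comp_assoc f g k h.tgt_src h₁, A.comp_congr h.comp_eq rfl, ident_comp]

theorem ident (A : InternalCategory C) {X : C} (x : X ⟶ A.obj) :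
    A.IsInverse (x ≫ A.ident) (x ≫ A.ident) where
  tgt_src := by simp [A.ident_src, A.ident_tgt]
  src_tgt := by simp [A.ident_src, A.ident_tgt]
  comp_eq := by rw [ident_comp]; simp [A.ident_src]
  comp_eq' := by rw [ident_comp]; simp [A.ident_tgt]

theorem comp {f' g' : X ⟶ A.arr} (h : A.IsInverse f g) (h' : A.IsInverse f' g')
    (e : f ≫ A.tgt = f' ≫ A.src) :
    A.IsInverse (A.comp f f' e) (A.comp g' g (by rw [h'.src_tgt, ← e, h.tgt_src])) where
  tgt_src := by rw [comp_src, comp_tgt, h'.tgt_src]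
  src_tgt := by rw [comp_src, comp_tgt, h.src_tgt]
  comp_eq := by
    rw [comp_assoc_elt, A.comp_congr rfl (h'.comp_comp g _ _), h.comp_eq, comp_src]
  comp_eq' := by
    rw [comp_assoc_elt, A.comp_congr rfl (h.symm.comp_comp f' _ _), h'.comp_eq', comp_tgt]

end IsInverse

-- Invertible natural transformations and conjugation of functors

theorem isInverse_of_iso {A B : InternalCategory C} {F G : A ⟶ B} (e : F ≅ G) :
    B.IsInverse (InternalNatTrans.app e.hom) (InternalNatTrans.app e.inv) where
  tgt_src := e.hom.app_tgt.trans e.inv.app_src.symm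
  src_tgt := e.inv.app_tgt.trans e.hom.app_src.symm
  comp_eq := by
    rw [← comp_app, e.hom_inv_id, id_app, e.hom.app_src]
  comp_eq' := by
    rw [← comp_app, e.inv_hom_id, id_app, e.hom.app_tgt]

/-- An internal natural transformation with invertible components is invertible. -/
noncomputable def isoOfIsInverse {A B : InternalCategory C} {F G : A ⟶ B} (α : F ⟶ G)
    (θ : A.obj ⟶ B.arr) (h : B.IsInverse (InternalNatTrans.app α) θ) : F ≅ G where
  hom := α
  inv := InternalNatTrans.mk (F := G) (G := F) θ (by rw [← h.tgt_src, α.app_tgt])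
    (by rw [h.src_tgt, α.app_src]) (by
      have h₁ := h.precomp A.src
      have h₂ := h.precomp A.tgt
      have n := α.naturality
      have e₁ : (A.src ≫ θ) ≫ B.tgt = F.arr ≫ B.src := by
        rw [Category.assoc, h.src_tgt, α.app_src, F.arr_src]
      have e₂ : F.arr ≫ B.tgt = (A.tgt ≫ InternalNatTrans.app α) ≫ B.src := by
        rw [Category.assoc, α.app_src, F.arr_tgt]
      have e₃ : G.arr ≫ B.tgt = (A.tgt ≫ θ) ≫ B.src := by
        rw [Category.assoc, ← h.tgt_src, α.app_tgt, G.arr_tgt]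
      have e₄ : (A.src ≫ InternalNatTrans.app α) ≫ B.tgt = G.arr ≫ B.src := by
        rw [Category.assoc, α.app_tgt, G.arr_src]
      -- Naturality of `α`, solved for `G.arr` by cancelling the component at the source; `k₂` then
      -- cancels the component at the target.
      have k₁ : G.arr = B.comp (A.src ≫ θ) (B.comp F.arr (A.tgt ≫ InternalNatTrans.app α) e₂)
          (by rw [comp_src, e₁]) := by
        rw [B.comp_congr rfl n, h₁.symm.comp_comp]
      have k₂ : B.comp (B.comp F.arr (A.tgt ≫ InternalNatTrans.app α) e₂) (A.tgt ≫ θ)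
          (by rw [comp_tgt, Category.assoc, Category.assoc, h.tgt_src]) = F.arr := by
        rw [comp_assoc_elt, B.comp_congr rfl h₂.comp_eq, comp_ident]
      refine (B.comp_congr k₁ rfl e₃).trans ?_
      rw [comp_assoc_elt]
      exact B.comp_congr rfl k₂ _)
  hom_inv_id := hom₂_ext (by
    rw [comp_app, id_app]
    exact h.comp_eq.trans (by rw [α.app_src]))
  inv_hom_id := hom₂_ext (by
    rw [comp_app, id_app]
    exact h.comp_eq'.trans (by rw [α.app_tgt]))

/-- Conjugation of an internal functor `F` by a family of isomorphisms with targets given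
by `F`. -/
noncomputable def transport {A B : InternalCategory C} (F : A ⟶ B) {θ θ' : A.obj ⟶ B.arr}
    (h : B.IsInverse θ θ') (ht : θ ≫ B.tgt = F.obj) : A ⟶ B :=
  InternalFunctor.mk (θ ≫ B.src)
    (B.comp (A.src ≫ θ) (B.comp F.arr (A.tgt ≫ θ')
        (by rw [F.arr_tgt, Category.assoc, ← h.tgt_src, ht]))
      (by rw [comp_src, F.arr_src, Category.assoc, ht]))
    (by rw [comp_src, Category.assoc])
    (by rw [comp_tgt, comp_tgt, Category.assoc, h.src_tgt])
    (by
      simp only [precomp_comp, reassoc_of% A.ident_src, reassoc_of% A.ident_tgt, F.ident_arr,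
        ident_comp, h.comp_eq])
    (by
      -- In a composite of two conjugates, the two inner components sit at the common middle object,
      -- so they are mutually inverse and cancel.
      have h₁ : B.IsInverse ((pullback.fst A.tgt A.src ≫ A.tgt) ≫ θ')
          ((pullback.snd A.tgt A.src ≫ A.src) ≫ θ) := by
        rw [← pullback.condition]
        exact h.symm.precomp _
      change _ = B.comp _ _ _
      simp only [precomp_comp, reassoc_of% A.mul_src, reassoc_of% A.mul_tgt, mul_arr F]
      simp only [comp_assoc_elt]
      simp only [Category.assoc] at h₁ ⊢
      exact B.comp_congr rfl (B.comp_congr rfl (h₁.comp_comp _ _ _).symm _) _)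

section

variable {A B : InternalCategory C} (F : A ⟶ B) {θ θ' : A.obj ⟶ B.arr}
  (h : B.IsInverse θ θ') (ht : θ ≫ B.tgt = F.obj)

theorem transport_obj : (transport F h ht).obj = θ ≫ B.src := rfl

/-- The isomorphism between a conjugate of `F` and `F`. -/
noncomputable def transportIso : transport F h ht ≅ F :=
  isoOfIsInverse (InternalNatTrans.mk (F := transport F h ht) (G := F) θ (transport_obj F h ht).symm
    ht (by
      have e₁ : F.arr ≫ B.tgt = (A.tgt ≫ θ') ≫ B.src := by
        rw [F.arr_tgt, Category.assoc, ← h.tgt_src, ht]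
      have e₂ : (A.tgt ≫ θ') ≫ B.tgt = (A.tgt ≫ θ) ≫ B.src := by
        rw [Category.assoc, Category.assoc, h.src_tgt]
      have k : B.comp (B.comp F.arr (A.tgt ≫ θ') e₁) (A.tgt ≫ θ) (by rw [comp_tgt, e₂]) =
          F.arr := by
        rw [comp_assoc_elt, B.comp_congr rfl (h.symm.precomp A.tgt).comp_eq, comp_ident]
      refine (B.comp_assoc (A.src ≫ θ) (B.comp F.arr (A.tgt ≫ θ') e₁) (A.tgt ≫ θ)
        (by rw [comp_src, Category.assoc, ht, F.arr_src]) (by rw [comp_tgt, e₂])).trans ?_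
      exact B.comp_congr rfl k _)) θ' h

/-- A functor isomorphic to `F` is determined by the components of the isomorphism. -/
theorem eq_transport {G : A ⟶ B} (α : G ⟶ F) (hα : InternalNatTrans.app α = θ) :
    G = transport F h ht := by
  subst hα
  refine InternalFunctor.ext α.app_src.symm ?_
  have e := α.naturality
  have e₁ : G.arr ≫ B.tgt = (A.tgt ≫ InternalNatTrans.app α) ≫ B.src := by
    rw [Category.assoc, α.app_src, G.arr_tgt]
  change _ = B.comp _ _ _
  rw [← B.comp_assoc _ _ _ (by rw [Category.assoc, ht, F.arr_src])
    (by rw [Category.assoc, ← h.tgt_src, ht, F.arr_tgt]), B.comp_congr e.symm rfl,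
    comp_assoc_elt, B.comp_congr rfl (h.precomp A.tgt).comp_eq, comp_ident]

end

/-- Both functors are the conjugate of `H` by the same components. This reduces the strict
equalities required of lifts and factorizations to equalities of components. -/
theorem functor_eq_of_iso_app_eq {A B : InternalCategory C} {F G H : A ⟶ B} (α : F ≅ H) (β : G ⟶ H)
    (h : InternalNatTrans.app α.hom = InternalNatTrans.app β) : F = G :=
  (eq_transport H (isInverse_of_iso α) α.hom.app_tgt α.hom rfl).trans
    (eq_transport H (isInverse_of_iso α) α.hom.app_tgt β h.symm).symm

/-! ### Fully faithful internal functors -/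

section FullyFaithful

variable {A B : InternalCategory C} {F : A ⟶ B}

theorem _root_.internalFullyFaithful.exists_lift (hF : internalFullyFaithful F) {X : C}
    (x y : X ⟶ A.obj) (g : X ⟶ B.arr) (hx : g ≫ B.src = x ≫ F.obj) (hy : g ≫ B.tgt = y ≫ F.obj) :
    ∃ f : X ⟶ A.arr, f ≫ A.src = x ∧ f ≫ A.tgt = y ∧ f ≫ F.arr = g := by
  have e : g ≫ prod.lift B.src B.tgt = prod.lift x y ≫ prod.map F.obj F.obj := by
    apply Limits.prod.hom_ext <;> simp [prod.lift_fst, prod.lift_snd, hx, hy]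
  refine ⟨hF.lift g (prod.lift x y) e, ?_, ?_, hF.lift_fst _ _ _⟩
  · simpa [-prod.comp_lift, prod.lift_fst, prod.lift_snd] using
      congrArg (fun k => k ≫ prod.fst) (hF.lift_snd g (prod.lift x y) e)
  · simpa [-prod.comp_lift, prod.lift_fst, prod.lift_snd] using
      congrArg (fun k => k ≫ prod.snd) (hF.lift_snd g (prod.lift x y) e)

theorem _root_.internalFullyFaithful.hom_ext (hF : internalFullyFaithful F) {X : C}
    {f g : X ⟶ A.arr} (hs : f ≫ A.src = g ≫ A.src) (ht : f ≫ A.tgt = g ≫ A.tgt)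
    (h : f ≫ F.arr = g ≫ F.arr) :
    f = g :=
  IsPullback.hom_ext hF h (by
    apply Limits.prod.hom_ext <;> simp [prod.lift_fst, prod.lift_snd, hs, ht])

/-- Full faithfulness in terms of generalized arrows. -/
theorem internalFullyFaithful_iff : internalFullyFaithful F ↔
    ∀ {X : C} (x y : X ⟶ A.obj) (g : X ⟶ B.arr), g ≫ B.src = x ≫ F.obj → g ≫ B.tgt = y ≫ F.obj →
      ∃! f : X ⟶ A.arr, f ≫ A.src = x ∧ f ≫ A.tgt = y ∧ f ≫ F.arr = g := by
  constructor
  · intro hF X x y g hx hy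
    obtain ⟨f, h₁, h₂, h₃⟩ := hF.exists_lift x y g hx hy
    exact ⟨f, ⟨h₁, h₂, h₃⟩, fun f' ⟨h₁', h₂', h₃'⟩ =>
      hF.hom_ext (h₁'.trans h₁.symm) (h₂'.trans h₂.symm) (h₃'.trans h₃.symm)⟩
  · intro h
    -- Existence and uniqueness are bundled for each cone, so that one choice supplies all the data
    -- of the limit.
    have K (s : PullbackCone (prod.lift B.src B.tgt) (prod.map F.obj F.obj)) :
        ∃ f : s.pt ⟶ A.arr, (f ≫ F.arr = s.fst ∧ f ≫ prod.lift A.src A.tgt = s.snd) ∧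
          ∀ f' : s.pt ⟶ A.arr, f' ≫ F.arr = s.fst → f' ≫ prod.lift A.src A.tgt = s.snd →
            f' = f := by
      have h₁ := congrArg (fun k => k ≫ prod.fst) s.condition
      have h₂ := congrArg (fun k => k ≫ prod.snd) s.condition
      simp only [Category.assoc, prod.lift_fst, prod.lift_snd, prod.map_fst, prod.map_snd]
        at h₁ h₂
      obtain ⟨f, ⟨hs, ht, hf⟩, hu⟩ := h (s.snd ≫ prod.fst) (s.snd ≫ prod.snd) s.fst
        (by rw [h₁, Category.assoc]) (by rw [h₂, Category.assoc])
      refine ⟨f, ⟨hf, ?_⟩, fun f' h₁' h₂' => hu f' ⟨?_, ?_, h₁'⟩⟩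
      · apply Limits.prod.hom_ext <;>
          simp only [Category.assoc, prod.lift_fst, prod.lift_snd, hs, ht]
      · rw [← h₂', Category.assoc, prod.lift_fst]
      · rw [← h₂', Category.assoc, prod.lift_snd]
    choose f hf hu using K
    exact ⟨⟨by apply Limits.prod.hom_ext <;>
        simp only [Category.assoc, prod.lift_fst, prod.lift_snd, prod.map_fst, prod.map_snd,
          prod.lift_fst_assoc, prod.lift_snd_assoc, F.arr_src, F.arr_tgt]⟩,
      ⟨PullbackCone.IsLimit.mk _ f (fun s => (hf s).1) (fun s => (hf s).2) hu⟩⟩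

theorem _root_.internalFullyFaithful.comp_ext (hF : internalFullyFaithful F) {X : C}
    {f g k : X ⟶ A.arr} (h : f ≫ A.tgt = g ≫ A.src) (hs : k ≫ A.src = f ≫ A.src)
    (ht : k ≫ A.tgt = g ≫ A.tgt)
    (e : k ≫ F.arr = B.comp (f ≫ F.arr) (g ≫ F.arr)
      (by rw [Category.assoc, Category.assoc, F.arr_src, F.arr_tgt, reassoc_of% h])) :
    k = A.comp f g h :=
  hF.hom_ext (by rw [comp_src, hs]) (by rw [comp_tgt, ht]) (by rw [e, comp_arr])

/-- Arrows with equal endpoints and equal images agree, so the inverse laws can be checked in `B`.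
-/
theorem _root_.internalFullyFaithful.isInverse (hF : internalFullyFaithful F) {X : C}
    {f g : X ⟶ A.arr} (h₁ : f ≫ A.tgt = g ≫ A.src) (h₂ : g ≫ A.tgt = f ≫ A.src)
    (h : B.IsInverse (f ≫ F.arr) (g ≫ F.arr)) : A.IsInverse f g where
  tgt_src := h₁
  src_tgt := h₂
  comp_eq := by
    symm
    refine hF.comp_ext h₁ (by simp [A.ident_src]) (by simp [A.ident_tgt, h₂]) ?_
    rw [h.comp_eq]
    simp only [Category.assoc, F.ident_arr, reassoc_of% F.arr_src]
  comp_eq' := by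
    symm
    refine hF.comp_ext h₂ (by simp [A.ident_src, h₁]) (by simp [A.ident_tgt]) ?_
    rw [h.comp_eq']
    simp only [Category.assoc, F.ident_arr, reassoc_of% F.arr_tgt]

theorem _root_.internalFullyFaithful.exists_lift_isInverse (hF : internalFullyFaithful F) {X : C}
    (x y : X ⟶ A.obj) {g g' : X ⟶ B.arr} (h : B.IsInverse g g') (hx : g ≫ B.src = x ≫ F.obj)
    (hy : g ≫ B.tgt = y ≫ F.obj) :
    ∃ f f' : X ⟶ A.arr, A.IsInverse f f' ∧ f ≫ A.src = x ∧ f ≫ A.tgt = y ∧ f ≫ F.arr = g := by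
  obtain ⟨f, h₁, h₂, h₃⟩ := hF.exists_lift x y g hx hy
  obtain ⟨f', h₁', h₂', h₃'⟩ := hF.exists_lift y x g' (by rw [← h.tgt_src, hy])
    (by rw [h.src_tgt, hx])
  exact ⟨f, f', hF.isInverse (h₂.trans h₁'.symm) (h₂'.trans h₁.symm) (by rwa [h₃, h₃']),
    h₁, h₂, h₃⟩

/-- An internal functor into the target of a fully faithful functor lifts as soon as its object
part does. -/
theorem _root_.internalFullyFaithful.exists_functor_lift (hF : internalFullyFaithful F)
    {E : InternalCategory C} (G : E ⟶ B) (g : E.obj ⟶ A.obj) (h : g ≫ F.obj = G.obj) :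
    ∃ H : E ⟶ A, H.obj = g ∧ H ≫ F = G := by
  obtain ⟨f, h₁, h₂, h₃⟩ := hF.exists_lift (E.src ≫ g) (E.tgt ≫ g) G.arr
    (by rw [G.arr_src, Category.assoc, h]) (by rw [G.arr_tgt, Category.assoc, h])
  refine ⟨InternalFunctor.mk g f h₁ h₂ ?_ ?_, rfl, InternalFunctor.ext h h₃⟩
  · refine hF.hom_ext ?_ ?_ ?_
    · simp only [Category.assoc, h₁, A.ident_src, reassoc_of% E.ident_src, Category.comp_id]
    · simp only [Category.assoc, h₂, A.ident_tgt, reassoc_of% E.ident_tgt, Category.comp_id]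
    · simp only [Category.assoc, h₃, G.ident_arr, F.ident_arr, reassoc_of% h]
  · refine hF.comp_ext _ ?_ ?_ ?_
    · simp only [Category.assoc, h₁, reassoc_of% E.mul_src]
    · simp only [Category.assoc, h₂, reassoc_of% E.mul_tgt]
    · simp only [Category.assoc, h₃, mul_arr G]

theorem _root_.internalFullyFaithful.functor_ext (hF : internalFullyFaithful F)
    {E : InternalCategory C} {G H : E ⟶ A} (h₀ : G.obj = H.obj) (h : G ≫ F = H ≫ F) : G = H :=
  InternalFunctor.ext h₀ (hF.hom_ext (by rw [G.arr_src, H.arr_src, h₀])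
    (by rw [G.arr_tgt, H.arr_tgt, h₀]) (congrArg InternalFunctor.arr h))

/-- Internal natural isomorphisms lift along fully faithful functors. -/
theorem _root_.internalFullyFaithful.exists_iso_lift (hF : internalFullyFaithful F)
    {E : InternalCategory C} {G H : E ⟶ A} (e : G ≫ F ≅ H ≫ F) :
    ∃ e' : G ≅ H, InternalNatTrans.app e'.hom ≫ F.arr = InternalNatTrans.app e.hom := by
  obtain ⟨f, f', hi, h₁, h₂, h₃⟩ := hF.exists_lift_isInverse G.obj H.obj (isInverse_of_iso e)
    e.hom.app_src e.hom.app_tgt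
  refine ⟨isoOfIsInverse (InternalNatTrans.mk (F := G) (G := H) f h₁ h₂ ?_) f' hi, h₃⟩
  refine hF.comp_ext _ ?_ ?_ ?_
  · rw [comp_src, G.arr_src, Category.assoc, h₁]
  · rw [comp_tgt, Category.assoc, h₂, H.arr_tgt]
  · have n := e.hom.naturality
    rw [comp_arr]
    refine (B.comp_congr rfl (by rw [Category.assoc, h₃]) _).trans
      (n.trans (B.comp_congr (by rw [Category.assoc, h₃]) rfl _))

end FullyFaithful

/-! ### The internal category induced by a map into the object of objects -/

section Induced

variable (B : InternalCategory C) {X : C} (e : X ⟶ B.obj)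

/-- The arrows of `B` between objects in the image of `e`. -/
noncomputable def inducedArr : C := pullback (prod.lift B.src B.tgt) (prod.map e e)

/-- The underlying arrow of `B`. -/
noncomputable def inducedArrι : inducedArr B e ⟶ B.arr := pullback.fst _ _

/-- The source in `X`. -/
noncomputable def inducedSrc : inducedArr B e ⟶ X := pullback.snd _ _ ≫ prod.fst

/-- The target in `X`. -/
noncomputable def inducedTgt : inducedArr B e ⟶ X := pullback.snd _ _ ≫ prod.snd

theorem inducedArrι_src : inducedArrι B e ≫ B.src = inducedSrc B e ≫ e := by
  have := congrArg (fun k => k ≫ prod.fst)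
    (pullback.condition (f := prod.lift B.src B.tgt) (g := prod.map e e))
  simp only [Category.assoc, prod.lift_fst, prod.map_fst] at this
  exact this.trans (Category.assoc _ _ _).symm

theorem inducedArrι_tgt : inducedArrι B e ≫ B.tgt = inducedTgt B e ≫ e := by
  have := congrArg (fun k => k ≫ prod.snd)
    (pullback.condition (f := prod.lift B.src B.tgt) (g := prod.map e e))
  simp only [Category.assoc, prod.lift_snd, prod.map_snd] at this
  exact this.trans (Category.assoc _ _ _).symm

variable {B e} in
theorem inducedArr_hom_ext {Y : C} {f g : Y ⟶ inducedArr B e}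
    (hs : f ≫ inducedSrc B e = g ≫ inducedSrc B e) (ht : f ≫ inducedTgt B e = g ≫ inducedTgt B e)
    (h : f ≫ inducedArrι B e = g ≫ inducedArrι B e) : f = g := by
  apply pullback.hom_ext h
  apply Limits.prod.hom_ext
  · exact (Category.assoc _ _ _).trans (hs.trans (Category.assoc _ _ _).symm)
  · exact (Category.assoc _ _ _).trans (ht.trans (Category.assoc _ _ _).symm)

variable {B e} in
/-- Generalized arrows of the induced category. -/
noncomputable def inducedLift {Y : C} (x y : Y ⟶ X) (g : Y ⟶ B.arr) (hx : g ≫ B.src = x ≫ e)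
    (hy : g ≫ B.tgt = y ≫ e) : Y ⟶ inducedArr B e :=
  pullback.lift g (prod.lift x y) (by
    apply Limits.prod.hom_ext <;> simp [prod.lift_fst, prod.lift_snd, hx, hy])

section

variable {B e} {Y : C} (x y : Y ⟶ X) (g : Y ⟶ B.arr) (hx : g ≫ B.src = x ≫ e)
  (hy : g ≫ B.tgt = y ≫ e)

theorem inducedLift_src : inducedLift x y g hx hy ≫ inducedSrc B e = x := by
  exact (pullback.lift_snd_assoc _ _ _ _).trans (prod.lift_fst _ _)

theorem inducedLift_tgt : inducedLift x y g hx hy ≫ inducedTgt B e = y := by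
  exact (pullback.lift_snd_assoc _ _ _ _).trans (prod.lift_snd _ _)

theorem inducedLift_ι : inducedLift x y g hx hy ≫ inducedArrι B e = g := by
  exact pullback.lift_fst _ _ _

end

/-- Composition in the induced category. -/
noncomputable def inducedMul :
    pullback (inducedTgt B e) (inducedSrc B e) ⟶ inducedArr B e :=
  have h : (pullback.fst (inducedTgt B e) (inducedSrc B e) ≫ inducedArrι B e) ≫ B.tgt =
      (pullback.snd (inducedTgt B e) (inducedSrc B e) ≫ inducedArrι B e) ≫ B.src := by
    rw [Category.assoc, Category.assoc, inducedArrι_src, inducedArrι_tgt,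
      pullback.condition_assoc]
  inducedLift (pullback.fst _ _ ≫ inducedSrc B e) (pullback.snd _ _ ≫ inducedTgt B e)
    (B.comp (pullback.fst _ _ ≫ inducedArrι B e) (pullback.snd _ _ ≫ inducedArrι B e) h)
    (by rw [comp_src, Category.assoc, Category.assoc, inducedArrι_src])
    (by rw [comp_tgt, Category.assoc, Category.assoc, inducedArrι_tgt])

theorem inducedMul_src :
    inducedMul B e ≫ inducedSrc B e = pullback.fst _ _ ≫ inducedSrc B e := by
  rw [inducedMul, inducedLift_src]

theorem inducedMul_tgt :
    inducedMul B e ≫ inducedTgt B e = pullback.snd _ _ ≫ inducedTgt B e := by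
  rw [inducedMul, inducedLift_tgt]

theorem inducedMul_ι :
    inducedMul B e ≫ inducedArrι B e =
      B.comp (pullback.fst _ _ ≫ inducedArrι B e) (pullback.snd _ _ ≫ inducedArrι B e)
        (by rw [Category.assoc, Category.assoc, inducedArrι_src, inducedArrι_tgt,
          pullback.condition_assoc]) := by
  rw [inducedMul, inducedLift_ι]

theorem lift_inducedMul_ι {Y : C} (f g : Y ⟶ inducedArr B e)
    (h : f ≫ inducedTgt B e = g ≫ inducedSrc B e) :
    (pullback.lift f g h ≫ inducedMul B e) ≫ inducedArrι B e =
      B.comp (f ≫ inducedArrι B e) (g ≫ inducedArrι B e)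
        (by rw [Category.assoc, Category.assoc, inducedArrι_src, inducedArrι_tgt,
          reassoc_of% h]) := by
  rw [Category.assoc, inducedMul_ι, precomp_comp]
  exact B.comp_congr (by rw [pullback.lift_fst_assoc]) (by rw [pullback.lift_snd_assoc]) _

theorem inducedIdent_src : (e ≫ B.ident) ≫ B.src = 𝟙 X ≫ e := by simp [B.ident_src]

theorem inducedIdent_tgt : (e ≫ B.ident) ≫ B.tgt = 𝟙 X ≫ e := by simp [B.ident_tgt]

/-- The internal category with object of objects `X` whose arrows are those of `B`. -/
noncomputable def induced : InternalCategory C where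
  obj := X
  arr := inducedArr B e
  src := inducedSrc B e
  tgt := inducedTgt B e
  ident := inducedLift (𝟙 X) (𝟙 X) (e ≫ B.ident) (inducedIdent_src B e) (inducedIdent_tgt B e)
  mul := inducedMul B e
  ident_src := inducedLift_src _ _ _ _ _
  ident_tgt := inducedLift_tgt _ _ _ _ _
  mul_src := inducedMul_src B e
  mul_tgt := inducedMul_tgt B e
  ident_mul := by
    refine inducedArr_hom_ext ?_ ?_ ?_
    · simp [inducedMul_src, pullback.lift_fst, pullback.lift_fst_assoc, inducedLift_src]
    · simp [inducedMul_tgt, pullback.lift_snd, pullback.lift_snd_assoc, inducedLift_tgt]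
    · rw [lift_inducedMul_ι]
      simp only [Category.assoc, inducedLift_ι, Category.id_comp]
      exact (B.comp_congr (Category.assoc _ _ _).symm rfl _).trans (ident_comp _ _ _ _)
  mul_ident := by
    refine inducedArr_hom_ext ?_ ?_ ?_
    · simp [inducedMul_src, pullback.lift_fst, pullback.lift_fst_assoc, inducedLift_src]
    · simp [inducedMul_tgt, pullback.lift_snd, pullback.lift_snd_assoc, inducedLift_tgt]
    · rw [lift_inducedMul_ι]
      simp only [Category.assoc, inducedLift_ι, Category.id_comp]
      exact (B.comp_congr rfl (Category.assoc _ _ _).symm _).trans (comp_ident _ _ _ _)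
  assoc f g h hfg hgh := by
    refine inducedArr_hom_ext ?_ ?_ ?_
    · simp [inducedMul_src, pullback.lift_fst, pullback.lift_fst_assoc]
    · simp [inducedMul_tgt, pullback.lift_snd, pullback.lift_snd_assoc]
    · simp only [lift_inducedMul_ι, comp_assoc_elt]

/-- The fully faithful functor from the induced category to `B`. -/
noncomputable def inducedFunctor : induced B e ⟶ B :=
  InternalFunctor.mk (A := induced B e) e (inducedArrι B e) (inducedArrι_src B e)
    (inducedArrι_tgt B e) (inducedLift_ι _ _ _ (inducedIdent_src B e) (inducedIdent_tgt B e))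
    (inducedMul_ι B e)

theorem inducedFunctor_fullyFaithful : internalFullyFaithful (inducedFunctor B e) := by
  have h : prod.lift (inducedSrc B e) (inducedTgt B e) = pullback.snd _ _ := by
    apply Limits.prod.hom_ext <;> simp [prod.lift_fst, prod.lift_snd, inducedSrc, inducedTgt]
  have := IsPullback.of_hasPullback (prod.lift B.src B.tgt) (prod.map e e)
  rwa [← h] at this

end Induced

/-! ### Discrete internal categories -/

/-- The discrete internal category on `X`. -/
noncomputable def discrete (X : C) : InternalCategory C where
  obj := X
  arr := X
  src := 𝟙 X
  tgt := 𝟙 X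
  ident := 𝟙 X
  mul := pullback.fst _ _
  ident_src := by simp
  ident_tgt := by simp
  mul_src := by simp
  mul_tgt := by simpa using pullback.condition (f := 𝟙 X) (g := 𝟙 X)
  ident_mul := by simp [pullback.lift_fst]
  mul_ident := by simp [pullback.lift_fst]
  assoc := by simp [pullback.lift_fst]

/-- The internal functor on a discrete internal category given by a generalized object. -/
noncomputable def discreteFunctor {X : C} {A : InternalCategory C} (x : X ⟶ A.obj) :
    discrete X ⟶ A :=
  InternalFunctor.mk (A := discrete X) x (x ≫ A.ident)
    (by simp [discrete, A.ident_src]) (by simp [discrete, A.ident_tgt]) (Category.id_comp _) (by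
      have h : pullback.snd (𝟙 X) (𝟙 X) = pullback.fst (𝟙 X) (𝟙 X) := by
        simpa using (pullback.condition (f := 𝟙 X) (g := 𝟙 X)).symm
      have k : pullback.fst (𝟙 X) (𝟙 X) ≫ x ≫ A.ident = A.comp
          (pullback.fst (𝟙 X) (𝟙 X) ≫ x ≫ A.ident) (pullback.snd (𝟙 X) (𝟙 X) ≫ x ≫ A.ident)
          (by rw [h]; simp [A.ident_src, A.ident_tgt]) := by
        simp only [h, ← Category.assoc]
        exact (ident_comp _ _ _ _).symm
      exact k)

/-- Every arrow of a discrete category is an identity, so preservation of identities fixes the arrow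
part. -/
theorem discrete_hom_ext {X : C} {A : InternalCategory C} {F G : discrete X ⟶ A}
    (h : F.obj = G.obj) : F = G := by
  refine InternalFunctor.ext h ?_
  have h₁ : F.arr = F.obj ≫ A.ident := (Category.id_comp _).symm.trans F.ident_arr
  have h₂ : G.arr = G.obj ≫ A.ident := (Category.id_comp _).symm.trans G.ident_arr
  rw [h₁, h₂, h]

/-- Natural transformations between functors on a discrete internal category are arbitrary
generalized arrows. -/
noncomputable def discreteNatTrans {X : C} {A : InternalCategory C} {F G : discrete X ⟶ A}
    (f : X ⟶ A.arr) (hs : f ≫ A.src = F.obj) (ht : f ≫ A.tgt = G.obj) : F ⟶ G :=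
  InternalNatTrans.mk (F := F) (G := G) f hs ht (by
    have h₁ : F.arr = F.obj ≫ A.ident := (Category.id_comp _).symm.trans F.ident_arr
    have h₂ : G.arr = G.obj ≫ A.ident := (Category.id_comp _).symm.trans G.ident_arr
    have h₃ : (discrete X).tgt ≫ f = f := Category.id_comp _
    have h₄ : (discrete X).src ≫ f = f := Category.id_comp _
    refine (A.comp_congr h₁ h₃ _).trans (Eq.trans ?_ (A.comp_congr h₄ h₂ _).symm)
    exact (ident_comp A F.obj f _).trans (comp_ident A G.obj f _).symm)

/-! ### Coproducts of objects -/

/-- Finite coproducts of internal categories give binary coproducts in `C`. -/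
theorem hasBinaryCoproducts [HasFiniteColimits (InternalCategory C)] : HasBinaryCoproducts C := by
  have H : ∀ X Y : C, HasBinaryCoproduct X Y := by
    intro X Y
    let S := discrete X ⨿ discrete Y
    let i : X ⟶ S.obj := InternalFunctor.obj (coprod.inl : discrete X ⟶ S)
    let j : Y ⟶ S.obj := InternalFunctor.obj (coprod.inr : discrete Y ⟶ S)
    have key : ∀ {T : C} (f : X ⟶ T) (g : Y ⟶ T), ∃ d : S.obj ⟶ T, i ≫ d = f ∧ j ≫ d = g := by
      intro T f g
      -- The indiscrete category on `T`: functors into it amount to maps into `T` on objects, so the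
      -- coproduct in `Cat(C)` can be tested against `T`.
      let I := induced (discrete (⊤_ C)) (terminal.from T)
      let d : S ⟶ I := coprod.desc (discreteFunctor (A := I) f) (discreteFunctor (A := I) g)
      exact ⟨d.obj, congrArg InternalFunctor.obj (coprod.inl_desc (discreteFunctor (A := I) f) _),
        congrArg InternalFunctor.obj (coprod.inr_desc _ (discreteFunctor (A := I) g))⟩
    have uniq : ∀ {T : C} (d d' : S.obj ⟶ T), i ≫ d = i ≫ d' → j ≫ d = j ≫ d' → d = d' := by
      intro T d d' h₁ h₂
      -- Any map on objects lifts `t` to the indiscrete category on `T`; the functors lifting `d`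
      -- and `d'` agree on both discrete summands, hence are equal.
      let t : S ⟶ discrete (⊤_ C) := coprod.desc (discreteFunctor (A := discrete (⊤_ C))
        (terminal.from X)) (discreteFunctor (A := discrete (⊤_ C)) (terminal.from Y))
      have ff := inducedFunctor_fullyFaithful (discrete (⊤_ C)) (terminal.from T)
      obtain ⟨D, hD, -⟩ := ff.exists_functor_lift t d (terminal.hom_ext _ _)
      obtain ⟨D', hD', -⟩ := ff.exists_functor_lift t d' (terminal.hom_ext _ _)
      have : D = D' := by
        apply coprod.hom_ext
        · apply discrete_hom_ext
          rw [comp_obj, comp_obj, hD, hD']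
          exact h₁
        · apply discrete_hom_ext
          rw [comp_obj, comp_obj, hD, hD']
          exact h₂
      rw [← hD, ← hD', this]
    exact ⟨⟨BinaryCofan.mk i j, BinaryCofan.IsColimit.mk _ (fun f g => (key f g).choose)
      (fun f g => (key f g).choose_spec.1) (fun f g => (key f g).choose_spec.2)
      (fun f g m h₁ h₂ => uniq _ _ (h₁.trans (key f g).choose_spec.1.symm)
        (h₂.trans (key f g).choose_spec.2.symm))⟩⟩
  exact hasBinaryCoproducts_of_hasColimit_pair C

end InternalCategory

-- Epimorphisms and projectives for the trivial topology

section

variable {C : Type u} [Category.{v} C]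

/-- The epimorphisms for the trivial topology are the split epimorphisms. -/
theorem topologyEpis_trivial_iff {E B : C} (p : E ⟶ B) :
    topologyEpis (GrothendieckTopology.trivial C) p ↔ ∃ q : B ⟶ E, q ≫ p = 𝟙 B := by
  constructor
  · intro hp
    let y : Cᵒᵖ ⥤ Type (max u v) := (uliftYoneda.{u} : C ⥤ Cᵒᵖ ⥤ Type (max u v)).obj B
    have : Epi ((presheafToSheaf (GrothendieckTopology.trivial C) (Type (max u v))).map
      ((uliftYoneda.{u} : C ⥤ Cᵒᵖ ⥤ Type (max u v)).map p)) := hp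
    have hsheaf (P : Cᵒᵖ ⥤ Type (max u v)) :
        Presheaf.IsSheaf (GrothendieckTopology.trivial C) P := by
      rw [GrothendieckTopology.trivial_eq_bot]
      exact Presheaf.isSheaf_bot P
    -- Every presheaf `Z` is already a sheaf, so maps into it transpose along the sheafification
    -- adjunction and can be cancelled there.
    have hepi : Epi ((uliftYoneda.{u} : C ⥤ Cᵒᵖ ⥤ Type (max u v)).map p) := by
      refine ⟨fun {Z} g h e => ?_⟩
      let Z' : Sheaf (GrothendieckTopology.trivial C) (Type (max u v)) := ⟨Z, hsheaf Z⟩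
      let adj := sheafificationAdjunction (GrothendieckTopology.trivial C) (Type (max u v))
      refine (adj.homEquiv _ Z').symm.injective ?_
      rw [← cancel_epi ((presheafToSheaf (GrothendieckTopology.trivial C) (Type (max u v))).map
        ((uliftYoneda.{u} : C ⥤ Cᵒᵖ ⥤ Type (max u v)).map p)),
        ← adj.homEquiv_naturality_left_symm, ← adj.homEquiv_naturality_left_symm]
      exact congrArg _ e
    -- Surjectivity at the object `B` itself: a preimage of `𝟙 B` is a section of `p`.
    have hsurj := (NatTrans.epi_iff_epi_app _).1 hepi (Opposite.op B)
    rw [epi_iff_surjective] at hsurj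
    obtain ⟨q, hq⟩ := hsurj ⟨𝟙 B⟩
    exact ⟨q.down, congrArg ULift.down hq⟩
  · rintro ⟨q, hq⟩
    have : IsSplitEpi p := ⟨⟨q, hq⟩⟩
    change Epi _
    infer_instance

theorem isTopologyProjective_trivial (P : C) :
    IsTopologyProjective (GrothendieckTopology.trivial C) P := by
  intro Q R G hG H
  obtain ⟨q, hq⟩ := (topologyEpis_trivial_iff G).1 hG
  exact ⟨H ≫ q, by rw [Category.assoc, hq, Category.comp_id]⟩

theorem enoughTopologyProjectives_trivial :
    EnoughTopologyProjectives (GrothendieckTopology.trivial C) := fun X =>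
  ⟨X, 𝟙 X, isTopologyProjective_trivial X,
    (topologyEpis_trivial_iff _).2 ⟨𝟙 X, Category.comp_id _⟩⟩

end

namespace InternalCategory

variable {C : Type u} [Category.{v} C] [HasFiniteLimits C] {A B : InternalCategory C}

/-! ### Generalized elements of mapping path objects -/

/-- The projection `(P_F)₀ ⟶ A₀`. -/
noncomputable def mappingPathObj (F : A ⟶ B) : mappingPath F ⟶ A.obj := pullback.fst _ _

/-- The projection `(P_F)₀ ⟶ iso(B)₁`. -/
noncomputable def mappingPathIso (F : A ⟶ B) : mappingPath F ⟶ B.isoArr := pullback.snd _ _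

/-- The arrow of `B` underlying a generalized element of `(P_F)₀`. -/
noncomputable def mappingPathArr (F : A ⟶ B) : mappingPath F ⟶ B.arr := mappingPathIso F ≫ B.isoι

/-- The inverse of the arrow of `B` underlying a generalized element of `(P_F)₀`. -/
noncomputable def mappingPathInv (F : A ⟶ B) : mappingPath F ⟶ B.arr :=
  mappingPathIso F ≫ B.isoInv

theorem mappingPath_isInverse (F : A ⟶ B) :
    B.IsInverse (mappingPathArr F) (mappingPathInv F) :=
  B.isInverse_iso.precomp _

theorem mappingPathArr_src (F : A ⟶ B) : mappingPathArr F ≫ B.src = mappingPathSrc F :=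
  Category.assoc _ _ _

theorem mappingPathArr_tgt (F : A ⟶ B) :
    mappingPathArr F ≫ B.tgt = mappingPathObj F ≫ F.obj :=
  (Category.assoc _ _ _).trans (pullback.condition (f := F.obj) (g := B.isoTgt)).symm

theorem exists_mappingPath_lift (F : A ⟶ B) {X : C} (a : X ⟶ A.obj) {φ φ' : X ⟶ B.arr}
    (h : B.IsInverse φ φ') (ht : φ ≫ B.tgt = a ≫ F.obj) :
    ∃ k : X ⟶ mappingPath F, k ≫ mappingPathObj F = a ∧ k ≫ mappingPathArr F = φ := by
  have e : a ≫ F.obj = B.isoLift φ φ' h ≫ B.isoTgt := by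
    rw [isoTgt, ← Category.assoc, isoLift_ι, ht]
  exact ⟨pullback.lift a (B.isoLift φ φ' h) e, pullback.lift_fst _ _ _,
    (pullback.lift_snd_assoc _ _ _ _).trans (isoLift_ι _ _ _ _)⟩

theorem mappingPath_hom_ext (F : A ⟶ B) {X : C} {k l : X ⟶ mappingPath F}
    (h₁ : k ≫ mappingPathObj F = l ≫ mappingPathObj F)
    (h₂ : k ≫ mappingPathArr F = l ≫ mappingPathArr F) : k = l :=
  pullback.hom_ext h₁ (B.iso_hom_ext
    ((Category.assoc _ _ _).trans (h₂.trans (Category.assoc _ _ _).symm)))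

theorem isoMap_ι (F : A ⟶ B) : isoMap F ≫ B.isoι = A.isoι ≫ F.arr := isoLift_ι _ _ _ _

theorem toMappingPath_obj (F : A ⟶ B) : toMappingPath F ≫ mappingPathObj F = A.isoTgt :=
  pullback.lift_fst _ _ _

theorem toMappingPath_arr (F : A ⟶ B) : toMappingPath F ≫ mappingPathArr F = A.isoι ≫ F.arr :=
  (pullback.lift_snd_assoc _ _ _ _).trans (isoMap_ι F)

/-- Essential surjectivity for the trivial topology in terms of generalized objects. -/
theorem topologyEpis_trivial_mappingPathSrc_iff (F : A ⟶ B) :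
    topologyEpis (GrothendieckTopology.trivial C) (mappingPathSrc F) ↔
      ∃ (a : B.obj ⟶ A.obj) (φ φ' : B.obj ⟶ B.arr), B.IsInverse φ φ' ∧ φ ≫ B.src = 𝟙 B.obj ∧
        φ ≫ B.tgt = a ≫ F.obj := by
  rw [topologyEpis_trivial_iff]
  constructor
  · rintro ⟨q, hq⟩
    refine ⟨q ≫ mappingPathObj F, _, _, (mappingPath_isInverse F).precomp q, ?_, ?_⟩
    · rw [Category.assoc, mappingPathArr_src, hq]
    · rw [Category.assoc, mappingPathArr_tgt, Category.assoc]
  · rintro ⟨a, φ, φ', h, hs, ht⟩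
    obtain ⟨k, -, hk⟩ := exists_mappingPath_lift F a h ht
    exact ⟨k, by rw [← mappingPathArr_src, ← Category.assoc, hk, hs]⟩

/-- Fibrations for the trivial topology in terms of generalized objects. -/
theorem topologyFibrations_trivial_iff (F : A ⟶ B) :
    topologyFibrations (GrothendieckTopology.trivial C) F ↔
      ∀ {X : C} (a : X ⟶ A.obj) {φ φ' : X ⟶ B.arr}, B.IsInverse φ φ' → φ ≫ B.tgt = a ≫ F.obj →
        ∃ θ θ' : X ⟶ A.arr, A.IsInverse θ θ' ∧ θ ≫ A.tgt = a ∧ θ ≫ F.arr = φ := by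
  refine (topologyEpis_trivial_iff _).trans ⟨?_, ?_⟩
  · rintro ⟨q, hq⟩ X a φ φ' h ht
    obtain ⟨k, hk₁, hk₂⟩ := exists_mappingPath_lift F a h ht
    have e₁ : q ≫ A.isoTgt = mappingPathObj F := by
      rw [← toMappingPath_obj F, ← Category.assoc, hq, Category.id_comp]
    have e₂ : q ≫ A.isoι ≫ F.arr = mappingPathArr F := by
      rw [← toMappingPath_arr F, ← Category.assoc, hq, Category.id_comp]
    refine ⟨_, _, A.isInverse_iso.precomp (k ≫ q), ?_, ?_⟩
    · rw [← hk₁, ← e₁]; simp [isoTgt]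
    · rw [← hk₂, ← e₂]; simp
  · intro h
    obtain ⟨θ, θ', hi, ht, hF⟩ := h (mappingPathObj F) (mappingPath_isInverse F)
      (mappingPathArr_tgt F)
    refine ⟨A.isoLift θ θ' hi, mappingPath_hom_ext F ?_ ?_⟩
    · rw [Category.id_comp, Category.assoc, toMappingPath_obj, isoTgt, ← Category.assoc,
        isoLift_ι, ht]
    · rw [Category.id_comp, Category.assoc, toMappingPath_arr, ← Category.assoc, isoLift_ι, hF]

/-! ### Equivalences -/

/-- A fully faithful internal functor with essentially split surjective object part is an
equivalence. -/
theorem isTwoEquivalence_of_topologyEquivalences {F : A ⟶ B}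
    (hF : topologyEquivalences (GrothendieckTopology.trivial C) F) : IsTwoEquivalence F := by
  obtain ⟨ff, hs⟩ := hF
  obtain ⟨a, φ, φ', h, hs, ht⟩ := (topologyEpis_trivial_mappingPathSrc_iff F).1 hs
  have ht' : φ' ≫ B.tgt = InternalFunctor.obj (𝟙 B) := by rw [h.src_tgt, hs]; rfl
  -- The identity of `B` is conjugated so that its object part becomes `a ≫ F.obj`, which factors
  -- through `F.obj`; full faithfulness then produces `G`.
  let τ := transportIso (𝟙 B) h.symm ht'
  obtain ⟨G, hG, hGF⟩ := ff.exists_functor_lift (transport (𝟙 B) h.symm ht') a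
    (by rw [transport_obj, ← h.tgt_src, ht])
  let ε : G ≫ F ≅ 𝟙 B := eqToIso hGF ≪≫ τ
  -- The other isomorphism is built after composing with `F` and reflected by full faithfulness. No
  -- triangle identity is needed.
  have e : (F ≫ G) ≫ F ≅ 𝟙 A ≫ F :=
    Bicategory.associator F G F ≪≫ Bicategory.whiskerLeftIso F ε ≪≫
      Bicategory.rightUnitor F ≪≫ (Bicategory.leftUnitor F).symm
  obtain ⟨e', -⟩ := ff.exists_iso_lift e
  exact ⟨G, ⟨e'⟩, ⟨ε⟩⟩

end InternalCategory

section

variable {K : Type u} [Bicategory.{w, v} K] [Bicategory.Strict K]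

/-- Equivalences in a 2-category are representably equivalences of categories. -/
theorem IsTwoEquivalence.isEquivalence_postcomp {A B : K} {f : A ⟶ B} (hf : IsTwoEquivalence f)
    (E : K) : (Bicategory.postcomp E f).IsEquivalence := by
  obtain ⟨g, ⟨η⟩, ⟨ε⟩⟩ := hf
  let e₁ : Bicategory.postcomp E f ⋙ Bicategory.postcomp E g ≅ 𝟭 (E ⟶ A) :=
    Bicategory.associatorNatIsoLeft E f g ≪≫ (Bicategory.postcomposing E A A).mapIso η ≪≫
      Bicategory.rightUnitorNatIso E A
  let e₂ : Bicategory.postcomp E g ⋙ Bicategory.postcomp E f ≅ 𝟭 (E ⟶ B) :=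
    Bicategory.associatorNatIsoLeft E g f ≪≫ (Bicategory.postcomposing E B B).mapIso ε ≪≫
      Bicategory.rightUnitorNatIso E B
  exact (CategoryTheory.Equivalence.mk _ _ e₁.symm e₂).isEquivalence_functor

end

namespace InternalCategory

variable {C : Type u} [Category.{v} C] [HasFiniteLimits C] {A B : InternalCategory C}

/-- Functors and transformations out of `discrete X` are generalized objects and arrows at stage
`X`. Full faithfulness is therefore tested at all `X`, and essential surjectivity on the generic
object, at stage `B.obj`. -/
theorem topologyEquivalences_of_isEquivalence {F : A ⟶ B}
    (hF : ∀ X : C, (Bicategory.postcomp (discrete X) F).IsEquivalence) :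
    topologyEquivalences (GrothendieckTopology.trivial C) F := by
  constructor
  · rw [internalFullyFaithful_iff]
    intro X x y g hx hy
    have := hF X
    let P := Bicategory.postcomp (discrete X) F
    let x' : discrete X ⟶ A := discreteFunctor x
    let y' : discrete X ⟶ A := discreteFunctor y
    let γ : P.obj x' ⟶ P.obj y' :=
      discreteNatTrans (F := x' ≫ F) (G := y' ≫ F) g hx hy
    obtain ⟨f, hf⟩ := P.map_surjective γ
    refine ⟨InternalNatTrans.app f, ⟨f.app_src, f.app_tgt, congrArg InternalNatTrans.app hf⟩, ?_⟩
    rintro f' ⟨h₁, h₂, h₃⟩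
    let f'' : x' ⟶ y' := discreteNatTrans (F := x') (G := y') f' h₁ h₂
    have : f'' = f := P.map_injective (hom₂_ext (h₃.trans (congrArg InternalNatTrans.app hf).symm))
    exact congrArg InternalNatTrans.app this
  · rw [topologyEpis_trivial_mappingPathSrc_iff]
    have := hF B.obj
    let P := Bicategory.postcomp (discrete B.obj) F
    let b : discrete B.obj ⟶ B := discreteFunctor (𝟙 _)
    let e : b ≅ P.objPreimage b ≫ F := (P.objObjPreimageIso b).symm
    let d : discrete B.obj ⟶ A := P.objPreimage b
    exact ⟨d.obj, _, _, isInverse_of_iso e, e.hom.app_src,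
      e.hom.app_tgt⟩

theorem topologyEquivalences_trivial_iff_isTwoEquivalence (F : A ⟶ B) :
    topologyEquivalences (GrothendieckTopology.trivial C) F ↔ IsTwoEquivalence F :=
  ⟨isTwoEquivalence_of_topologyEquivalences, fun h =>
    topologyEquivalences_of_isEquivalence fun X => h.isEquivalence_postcomp (discrete X)⟩

theorem topologyEquivalences_trivial_eq :
    topologyEquivalences (GrothendieckTopology.trivial C) =
      trivialModelWeakEquivalences (InternalCategory C) := by
  ext A B F
  exact ⟨fun h E => ((topologyEquivalences_trivial_iff_isTwoEquivalence F).1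
    h).isEquivalence_postcomp E, fun h => topologyEquivalences_of_isEquivalence fun X => h _⟩

/-! ### Fibrations -/

/-- The lifting of 2-dimensional isomorphisms along fibrations. -/
theorem exists_functor_lift_of_topologyFibrations {F : A ⟶ B} {E : InternalCategory C}
    (H : E ⟶ A) (K : E ⟶ B) (β : K ≅ H ≫ F) {θ θ' : E.obj ⟶ A.arr} (h : A.IsInverse θ θ')
    (ht : θ ≫ A.tgt = H.obj) (hβ : θ ≫ F.arr = InternalNatTrans.app β.hom) :
    transport H h ht ≫ F = K := by
  let γ := Bicategory.whiskerRightIso (transportIso H h ht) F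
  exact functor_eq_of_iso_app_eq γ β.hom hβ

/-- To lift an isomorphism of functors it suffices to lift its components, a lifting problem at
stage `E.obj`; conjugation supplies the functor and the strict equality. For the converse, `E` is
taken discrete. -/
theorem topologyFibrations_trivial_eq :
    topologyFibrations (GrothendieckTopology.trivial C) =
      trivialModelFibrations (InternalCategory C) := by
  ext A B F
  refine (topologyFibrations_trivial_iff F).trans ⟨?_, ?_⟩
  · intro hF E H K β
    obtain ⟨θ, θ', h, ht, hβ⟩ := hF H.obj (isInverse_of_iso β) β.hom.app_tgt
    refine ⟨transport H h ht, transportIso H h ht,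
      exists_functor_lift_of_topologyFibrations H K β h ht hβ, hom₂_ext ?_⟩
    exact hβ.trans (eqToHom_comp_app _ _).symm
  · intro hF X a φ φ' h ht
    let d : discrete X ⟶ A := discreteFunctor a
    let e : discrete X ⟶ B := discreteFunctor (φ ≫ B.src)
    let β : e ≅ d ≫ F := isoOfIsInverse (discreteNatTrans (F := e) (G := d ≫ F) φ rfl ht) φ' h
    obtain ⟨d', α, h', hα⟩ := hF (discrete X) d e β
    refine ⟨_, _, isInverse_of_iso α, α.hom.app_tgt, ?_⟩
    exact (congrArg InternalNatTrans.app hα).trans (eqToHom_comp_app _ _)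

end InternalCategory

-- Maps out of a binary coproduct

section

variable {C : Type u} [Category.{v} C]

theorem binaryCofan_exists_desc {X Y S T : C} {i : X ⟶ S} {j : Y ⟶ S}
    (hc : IsColimit (BinaryCofan.mk i j)) (f : X ⟶ T) (g : Y ⟶ T) :
    ∃ l : S ⟶ T, i ≫ l = f ∧ j ≫ l = g := by
  obtain ⟨l, h₁, h₂⟩ := BinaryCofan.IsColimit.desc' hc f g
  exact ⟨l, h₁, h₂⟩

theorem binaryCofan_hom_ext {X Y S T : C} {i : X ⟶ S} {j : Y ⟶ S}
    (hc : IsColimit (BinaryCofan.mk i j)) {a b : S ⟶ T} (h₁ : i ≫ a = i ≫ b)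
    (h₂ : j ≫ a = j ≫ b) : a = b :=
  BinaryCofan.IsColimit.hom_ext hc h₁ h₂

end

namespace InternalCategory

variable {C : Type u} [Category.{v} C] [HasFiniteLimits C] {A B : InternalCategory C}

/-! ### Acyclic fibrations and cofibrations -/

/-- The section on objects lifts the identity of `B` to `G`. Then `F ≫ G` and `𝟙 A` become equal
after `F`, so full faithfulness makes them isomorphic. -/
theorem _root_.internalFullyFaithful.exists_section {F : A ⟶ B} (ff : internalFullyFaithful F)
    (s : B.obj ⟶ A.obj) (hs : s ≫ F.obj = 𝟙 B.obj) :
    ∃ G : B ⟶ A, G ≫ F = 𝟙 B ∧ Nonempty (F ≫ G ≅ 𝟙 A) := by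
  obtain ⟨G, -, hGF⟩ := ff.exists_functor_lift (𝟙 B) s hs
  refine ⟨G, hGF, ?_⟩
  have e : (F ≫ G) ≫ F = 𝟙 A ≫ F := by
    rw [Category.assoc, hGF, Category.comp_id, Category.id_comp]
  obtain ⟨e', -⟩ := ff.exists_iso_lift (G := F ≫ G) (H := 𝟙 A) (eqToIso e)
  exact ⟨e'⟩

/-- Essential surjectivity gives an isomorphism from the generic object of `B` to an object in the
image of `F`. Lifting it along the fibration replaces this by a strict preimage, the source of the
lift. -/
theorem exists_section_of_acyclic {F : A ⟶ B}
    (hF : acyclicTopologyFibrations (GrothendieckTopology.trivial C) F) :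
    ∃ s : B.obj ⟶ A.obj, s ≫ F.obj = 𝟙 B.obj := by
  obtain ⟨a, φ, φ', h, hs, ht⟩ := (topologyEpis_trivial_mappingPathSrc_iff F).1 hF.2.2
  obtain ⟨θ, θ', -, -, hθ⟩ := (topologyFibrations_trivial_iff F).1 hF.1 a h ht
  exact ⟨θ ≫ A.src, by rw [Category.assoc, ← F.arr_src, ← Category.assoc, hθ, hs]⟩

/-- The acyclic fibrations are the retractions of strong deformation retracts. -/
theorem acyclicTopologyFibrations_trivial_iff (F : A ⟶ B) :
    acyclicTopologyFibrations (GrothendieckTopology.trivial C) F ↔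
      ∃ G : B ⟶ A, G ≫ F = 𝟙 B ∧ Nonempty (F ≫ G ≅ 𝟙 A) := by
  constructor
  · intro hF
    obtain ⟨s, hs⟩ := exists_section_of_acyclic hF
    exact hF.2.1.exists_section s hs
  · rintro ⟨G, hGF, ⟨η⟩⟩
    have hW := (topologyEquivalences_trivial_iff_isTwoEquivalence F).2
      ⟨G, ⟨η⟩, ⟨eqToIso hGF⟩⟩
    refine ⟨(topologyFibrations_trivial_iff F).2 ?_, hW⟩
    intro X a φ φ' h ht
    -- Applying `G` to the source of `φ` gives a strict preimage of it, so full faithfulness lifts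
    -- `φ` itself with the prescribed target.
    obtain ⟨f, f', hf, -, h₂, h₃⟩ := hW.1.exists_lift_isInverse (φ ≫ B.src ≫ G.obj) a h (by
      have := congrArg InternalFunctor.obj hGF
      simp only [comp_obj, id_obj] at this
      simp only [Category.assoc, this, Category.comp_id]) ht
    exact ⟨f, f', hf, h₂, h₃⟩

/-- An internal functor whose object part is a coproduct injection is a cofibration. -/
theorem topologyCofibrations_of_isColimit {G : A ⟶ B} {W : C} (i : W ⟶ B.obj)
    (hc : IsColimit (BinaryCofan.mk G.obj i)) :
    topologyCofibrations (GrothendieckTopology.trivial C) G := by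
  intro X Y p hp
  obtain ⟨s, hs⟩ := exists_section_of_acyclic hp
  refine ⟨fun {f g} sq => ?_⟩
  -- On objects, the lift is `f` on the old summand and `g` followed by the section of `p` on the
  -- new one; full faithfulness of `p` extends it to arrows.
  obtain ⟨l, hl₁, hl₂⟩ := binaryCofan_exists_desc hc (InternalFunctor.obj f)
    (i ≫ InternalFunctor.obj g ≫ s)
  have w₀ : InternalFunctor.obj f ≫ InternalFunctor.obj p = G.obj ≫ InternalFunctor.obj g :=
    congrArg InternalFunctor.obj sq.w
  obtain ⟨L, hL, hLp⟩ := hp.2.1.exists_functor_lift g l (by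
    refine binaryCofan_hom_ext hc ?_ ?_
    · rw [reassoc_of% hl₁, w₀]
    · rw [reassoc_of% hl₂, hs, Category.comp_id])
  refine ⟨⟨⟨L, hp.2.1.functor_ext ?_ ?_, hLp⟩⟩⟩
  · rw [comp_obj, hL, hl₁]
  · rw [Category.assoc, hLp, sq.w]

/-- The mapping cylinder factorization. -/
theorem exists_cylinder_factorization [HasBinaryCoproducts C] (F : A ⟶ B) :
    ∃ (Z : InternalCategory C) (j : A ⟶ Z) (p : Z ⟶ B), j ≫ p = F ∧
      topologyCofibrations (GrothendieckTopology.trivial C) j ∧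
      acyclicTopologyFibrations (GrothendieckTopology.trivial C) p := by
  -- The second summand serves to make `coprod.inr` a section of the object part.
  let e : A.obj ⨿ B.obj ⟶ B.obj := coprod.desc F.obj (𝟙 _)
  have ff := inducedFunctor_fullyFaithful B e
  obtain ⟨j, hj, hjp⟩ := ff.exists_functor_lift F coprod.inl (coprod.inl_desc _ _)
  refine ⟨induced B e, j, inducedFunctor B e, hjp, ?_, ?_⟩
  · refine topologyCofibrations_of_isColimit (coprod.inr : B.obj ⟶ A.obj ⨿ B.obj) ?_
    rw [hj]
    exact coprodIsCoprod A.obj B.obj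
  · exact (acyclicTopologyFibrations_trivial_iff _).2
      (ff.exists_section coprod.inr (coprod.inr_desc _ _))

/-! ### The factorization through the mapping path object -/

theorem comp_cancel_right {X : C} {f f' g g' : X ⟶ B.arr} (hg : B.IsInverse g g')
    (h : f ≫ B.tgt = g ≫ B.src) (h' : f' ≫ B.tgt = g ≫ B.src)
    (e : B.comp f g h = B.comp f' g h') : f = f' := by
  have key : ∀ (k : X ⟶ B.arr) (hk : k ≫ B.tgt = g ≫ B.src),
      B.comp (B.comp k g hk) g' (by rw [comp_tgt, hg.tgt_src]) = k := by
    intro k hk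
    rw [comp_assoc_elt, B.comp_congr rfl hg.comp_eq, comp_ident]
  rw [← key f h, ← key f' h', B.comp_congr e rfl]

theorem isInverse_of_isColimit {X Y S : C} {i : X ⟶ S} {j : Y ⟶ S}
    (hc : IsColimit (BinaryCofan.mk i j)) {f g : S ⟶ B.arr} (h₁ : B.IsInverse (i ≫ f) (i ≫ g))
    (h₂ : B.IsInverse (j ≫ f) (j ≫ g)) : B.IsInverse f g := by
  have ext : ∀ {T : C} {a b : S ⟶ T}, i ≫ a = i ≫ b → j ≫ a = j ≫ b → a = b :=
    binaryCofan_hom_ext hc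
  have e₁ : f ≫ B.tgt = g ≫ B.src :=
    ext (by simpa using h₁.tgt_src) (by simpa using h₂.tgt_src)
  have e₂ : g ≫ B.tgt = f ≫ B.src :=
    ext (by simpa using h₁.src_tgt) (by simpa using h₂.src_tgt)
  refine ⟨e₁, e₂, ext ?_ ?_, ext ?_ ?_⟩
  · rw [precomp_comp, h₁.comp_eq]; simp
  · rw [precomp_comp, h₂.comp_eq]; simp
  · rw [precomp_comp, h₁.comp_eq']; simp
  · rw [precomp_comp, h₂.comp_eq']; simp

/-- A factorization of `F : A ⟶ B` through the category with objects `A₀ ⨿ (P_F)₀` and arrows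
those of `A`. -/
structure PathFactorization (F : A ⟶ B) where
  /-- the intermediate internal category -/
  Z : InternalCategory C
  /-- the first functor -/
  j : A ⟶ Z
  /-- the second functor -/
  q : Z ⟶ B
  /-- the retraction of `j` -/
  π : Z ⟶ A
  /-- the inclusion of the second summand of the object of objects -/
  i : mappingPath F ⟶ Z.obj
  /-- the objects are a coproduct -/
  isColimit : IsColimit (BinaryCofan.mk j.obj i)
  /-- the comparison isomorphism -/
  α : q ≅ π ≫ F
  fac : j ≫ q = F
  retract : j ≫ π = 𝟙 A
  fullyFaithful : internalFullyFaithful π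
  i_π : i ≫ π.obj = mappingPathObj F
  i_α : i ≫ InternalNatTrans.app α.hom = mappingPathArr F

/-- `q` is `π ≫ F` conjugated by identities on `A₀` and by the tautological isomorphism on `(P_F)₀`.
Thus it restricts strictly to `F` along `j` and sends an object `(a, b ≅ F a)` to `b`. -/
theorem nonempty_pathFactorization [HasBinaryCoproducts C] (F : A ⟶ B) :
    Nonempty (PathFactorization F) := by
  let e : A.obj ⨿ mappingPath F ⟶ A.obj := coprod.desc (𝟙 _) (mappingPathObj F)
  have ff := inducedFunctor_fullyFaithful A e
  obtain ⟨j, hj, hjπ⟩ := ff.exists_functor_lift (𝟙 A) coprod.inl (coprod.inl_desc _ _)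
  let ζ : A.obj ⨿ mappingPath F ⟶ B.arr := coprod.desc (F.obj ≫ B.ident) (mappingPathArr F)
  let ζ' : A.obj ⨿ mappingPath F ⟶ B.arr := coprod.desc (F.obj ≫ B.ident) (mappingPathInv F)
  have h₁ : (coprod.inl : A.obj ⟶ A.obj ⨿ mappingPath F) ≫ ζ = F.obj ≫ B.ident :=
    coprod.inl_desc _ _
  have h₂ : (coprod.inr : mappingPath F ⟶ A.obj ⨿ mappingPath F) ≫ ζ = mappingPathArr F :=
    coprod.inr_desc _ _
  have h₁' : (coprod.inl : A.obj ⟶ A.obj ⨿ mappingPath F) ≫ ζ' = F.obj ≫ B.ident :=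
    coprod.inl_desc _ _
  have h₂' : (coprod.inr : mappingPath F ⟶ A.obj ⨿ mappingPath F) ≫ ζ' = mappingPathInv F :=
    coprod.inr_desc _ _
  have hζ : B.IsInverse ζ ζ' :=
    isInverse_of_isColimit (coprodIsCoprod A.obj (mappingPath F))
      (by rw [h₁, h₁']; exact IsInverse.ident B F.obj)
      (by rw [h₂, h₂']; exact mappingPath_isInverse F)
  have ht : ζ ≫ B.tgt = InternalFunctor.obj (inducedFunctor A e ≫ F) := by
    change ζ ≫ B.tgt = e ≫ F.obj
    refine coprod.hom_ext ?_ ?_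
    · rw [reassoc_of% h₁, B.ident_tgt, coprod.inl_desc_assoc, Category.id_comp, Category.comp_id]
    · rw [reassoc_of% h₂, mappingPathArr_tgt, coprod.inr_desc_assoc]
  have e' : F = j ≫ inducedFunctor A e ≫ F := by
    rw [← Category.assoc, hjπ, Category.id_comp]
  refine ⟨⟨induced A e, j, transport _ hζ ht, inducedFunctor A e, coprod.inr, ?_,
    transportIso _ hζ ht, ?_, hjπ, ff, coprod.inr_desc _ _, h₂⟩⟩
  · rw [hj]
    exact coprodIsCoprod A.obj (mappingPath F)
  · refine functor_eq_of_iso_app_eq (Bicategory.whiskerLeftIso j (transportIso _ hζ ht))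
      (eqToHom e') ?_
    rw [eqToHom_app]
    change j.obj ≫ ζ = _
    rw [hj]
    exact h₁

-- Lifting properties of the two factors

namespace PathFactorization

variable {F : A ⟶ B} (d : PathFactorization F)

theorem hom_ext {T : C} {a b : d.Z.obj ⟶ T} (h₁ : d.j.obj ≫ a = d.j.obj ≫ b)
    (h₂ : d.i ≫ a = d.i ≫ b) : a = b :=
  binaryCofan_hom_ext d.isColimit h₁ h₂

/-- An isomorphism `φ : b ≅ q z`, composed with `α` at `z`, is an isomorphism `b ≅ F (π z)`, hence
an object of `Z` in the summand `(P_F)₀` which `q` sends to `b`. It has the same image under `π` as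
`z`, and the isomorphism lying over the identity lifts `φ`. -/
theorem fibration_q : topologyFibrations (GrothendieckTopology.trivial C) d.q := by
  rw [topologyFibrations_trivial_iff]
  intro X z φ φ' h ht
  have hα := (isInverse_of_iso d.α).precomp z
  have e₁ : φ ≫ B.tgt = (z ≫ InternalNatTrans.app d.α.hom) ≫ B.src := by
    rw [ht, Category.assoc, d.α.hom.app_src]
  obtain ⟨k, hk₁, hk₂⟩ := exists_mappingPath_lift F (z ≫ d.π.obj) (h.comp hα e₁)
    (by rw [comp_tgt, Category.assoc, d.α.hom.app_tgt, comp_obj, Category.assoc])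
  have hk₃ : (k ≫ d.i) ≫ d.π.obj = z ≫ d.π.obj := by rw [Category.assoc, d.i_π, hk₁]
  obtain ⟨θ, θ', hθ, hs, ht', hπ⟩ := d.fullyFaithful.exists_lift_isInverse (k ≫ d.i) z
    (IsInverse.ident A (z ≫ d.π.obj)) (by rw [hk₃, Category.assoc, A.ident_src, Category.comp_id])
    (by rw [Category.assoc, A.ident_tgt, Category.comp_id])
  refine ⟨θ, θ', hθ, ht', ?_⟩
  have c₁ : (θ ≫ d.q.arr) ≫ B.tgt = (z ≫ InternalNatTrans.app d.α.hom) ≫ B.src := by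
    rw [Category.assoc, d.q.arr_tgt, reassoc_of% ht', Category.assoc, d.α.hom.app_src]
  have c₂ : B.comp φ (z ≫ InternalNatTrans.app d.α.hom) e₁ ≫ B.tgt =
      (((z ≫ d.π.obj) ≫ F.obj) ≫ B.ident) ≫ B.src := by
    rw [comp_tgt, Category.assoc, d.α.hom.app_tgt, Category.assoc, B.ident_src]
    simp
  -- It remains to compare after composing with `α` at `z`; naturality of `α` at `θ` applies, and
  -- `θ` becomes an identity under `π`.
  refine comp_cancel_right hα c₁ e₁ ?_
  have n := naturality_elt d.α.hom θ (by rw [Category.assoc, Category.assoc, Category.assoc,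
    d.α.hom.app_src, d.q.arr_tgt]) (by rw [Category.assoc, Category.assoc, Category.assoc,
    d.α.hom.app_tgt, InternalFunctor.arr_src])
  refine (B.comp_congr rfl (by rw [reassoc_of% ht']) _).trans (n.trans ?_)
  refine (B.comp_congr ?_ ?_ _).trans (comp_ident B ((z ≫ d.π.obj) ≫ F.obj) _ c₂)
  · rw [reassoc_of% hs, d.i_α, hk₂]
  · rw [comp_arr', reassoc_of% hπ, F.ident_arr]; simp

/-- `π` equalizes `𝟙 Z` and `π ≫ j`, so the identity lifts to `κ`. By uniqueness of lifts `κ` is the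
identity along `j`: `j` is the inclusion of a strong deformation retract. -/
theorem exists_iso : ∃ κ : 𝟙 d.Z ≅ d.π ≫ d.j,
    d.j.obj ≫ InternalNatTrans.app κ.hom = d.j.obj ≫ d.Z.ident := by
  have e : 𝟙 d.Z ≫ d.π = (d.π ≫ d.j) ≫ d.π := by
    rw [Category.assoc, d.retract, Category.comp_id, Category.id_comp]
  obtain ⟨κ, hκ⟩ := d.fullyFaithful.exists_iso_lift (G := 𝟙 d.Z) (H := d.π ≫ d.j) (eqToIso e)
  have r₀ : d.j.obj ≫ d.π.obj = 𝟙 _ := congrArg InternalFunctor.obj d.retract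
  refine ⟨κ, d.fullyFaithful.hom_ext ?_ ?_ ?_⟩
  · rw [Category.assoc, Category.assoc, κ.hom.app_src, d.Z.ident_src]; rfl
  · rw [Category.assoc, Category.assoc, κ.hom.app_tgt, d.Z.ident_tgt, comp_obj,
      reassoc_of% r₀, Category.comp_id]
  · rw [Category.assoc, Category.assoc, hκ, d.π.ident_arr, eqToIso.hom, eqToHom_app, comp_obj,
      id_obj, Category.id_comp]

theorem isTwoEquivalence_j : IsTwoEquivalence d.j := by
  obtain ⟨κ, -⟩ := d.exists_iso
  exact ⟨d.π, ⟨eqToIso d.retract⟩, ⟨κ.symm⟩⟩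

/-- The functor `π ≫ u` solves the lifting problem up to the isomorphism `β` obtained from `κ`.
Lifting `β` along the fibration `p` and conjugating corrects the lower triangle; lifting by
identities over `A₀` keeps the upper one strict. -/
theorem j_mem_llp : (topologyFibrations (GrothendieckTopology.trivial C)).llp d.j := by
  intro X Y p hp
  refine ⟨fun {u v} sq => ?_⟩
  obtain ⟨κ, hκ⟩ := d.exists_iso
  have e : (d.π ≫ d.j) ≫ v = (d.π ≫ u) ≫ p := by
    rw [Category.assoc, Category.assoc, sq.w]
  let β : v ≅ (d.π ≫ u) ≫ p :=
    (eqToIso (Category.id_comp v).symm ≪≫ Bicategory.whiskerRightIso κ v) ≪≫ eqToIso e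
  have hβ : InternalNatTrans.app β.hom = InternalNatTrans.app κ.hom ≫ InternalFunctor.arr v :=
    (comp_eqToHom_app _ e).trans (eqToHom_comp_app (Category.id_comp v).symm _)
  have hi := isInverse_of_iso β
  obtain ⟨θ₁, θ₁', hθ₁, ht₁, hp₁⟩ := (topologyFibrations_trivial_iff p).1 hp
    (d.i ≫ InternalFunctor.obj (d.π ≫ u)) (hi.precomp d.i)
    (by rw [Category.assoc, β.hom.app_tgt, comp_obj (d.π ≫ u) p, Category.assoc])
  -- The components are prescribed separately on the two summands: identities on `A₀`, which is
  -- consistent because `β` is the identity along `j`, and lifts along `p` on `(P_F)₀`.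
  obtain ⟨θ, h₁, h₂⟩ := binaryCofan_exists_desc d.isColimit
    (InternalFunctor.obj u ≫ X.ident) θ₁
  obtain ⟨θ', h₁', h₂'⟩ := binaryCofan_exists_desc d.isColimit
    (InternalFunctor.obj u ≫ X.ident) θ₁'
  have hθ : X.IsInverse θ θ' := isInverse_of_isColimit d.isColimit
    (by rw [h₁, h₁']; exact IsInverse.ident X _) (by rwa [h₂, h₂'])
  have r₀ : d.j.obj ≫ d.π.obj = 𝟙 _ := congrArg InternalFunctor.obj d.retract
  have w₀ : InternalFunctor.obj u ≫ InternalFunctor.obj p = d.j.obj ≫ InternalFunctor.obj v :=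
    congrArg InternalFunctor.obj sq.w
  have ht : θ ≫ X.tgt = InternalFunctor.obj (d.π ≫ u) := by
    refine d.hom_ext ?_ ?_
    · rw [reassoc_of% h₁, X.ident_tgt, comp_obj, reassoc_of% r₀, Category.comp_id]
    · rw [reassoc_of% h₂, ht₁]
  have hθβ : θ ≫ InternalFunctor.arr p = InternalNatTrans.app β.hom := by
    refine d.hom_ext ?_ ?_
    · rw [reassoc_of% h₁, InternalFunctor.ident_arr, hβ, reassoc_of% hκ,
        InternalFunctor.ident_arr, reassoc_of% w₀]
    · rw [reassoc_of% h₂, hp₁]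
  refine ⟨⟨⟨transport (d.π ≫ u) hθ ht, ?_,
    exists_functor_lift_of_topologyFibrations (d.π ≫ u) v β hθ ht hθβ⟩⟩⟩
  have e' : u = d.j ≫ d.π ≫ u := by rw [← Category.assoc, d.retract, Category.id_comp]
  refine functor_eq_of_iso_app_eq (Bicategory.whiskerLeftIso d.j (transportIso _ hθ ht))
    (eqToHom e') ?_
  rw [eqToHom_app]
  exact h₁

end PathFactorization

end InternalCategory

namespace InternalCategory

variable {C : Type u} [Category.{v} C] [HasFiniteLimits C]

/-! ### The weak factorization systems -/

theorem acyclicTopologyFibrations_le_topologyFibrations (T : GrothendieckTopology C) :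
    acyclicTopologyFibrations T ≤ topologyFibrations T := fun _ _ _ h => h.1

/-- Retract argument: a map `f` lifting against the cylinder inclusion `j` is a retract of the
acyclic fibration `p`. A section of `p` followed by the lift is a section of `f`, and the
isomorphism for `p` whiskers to one for `f`. -/
theorem topologyCofibrations_rlp [HasBinaryCoproducts C] :
    (topologyCofibrations (GrothendieckTopology.trivial C)).rlp =
      acyclicTopologyFibrations (GrothendieckTopology.trivial C) := by
  refine le_antisymm ?_ ((MorphismProperty.le_llp_iff_le_rlp _ _).1 le_rfl)
  intro A B f hf
  obtain ⟨Z, j, p, hjp, hj, hp⟩ := exists_cylinder_factorization f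
  have := hf j hj
  have sq : CommSq (𝟙 A) j f p := ⟨by rw [hjp, Category.id_comp]⟩
  obtain ⟨G, hG, ⟨η⟩⟩ := (acyclicTopologyFibrations_trivial_iff p).1 hp
  refine (acyclicTopologyFibrations_trivial_iff f).2 ⟨G ≫ sq.lift, ?_, ⟨?_⟩⟩
  · rw [Category.assoc, sq.fac_right, hG]
  · have e₁ : f ≫ G ≫ sq.lift = j ≫ (p ≫ G) ≫ sq.lift := by simp only [← hjp, Category.assoc]
    have e₂ : j ≫ 𝟙 Z ≫ sq.lift = 𝟙 A := by rw [Category.id_comp, sq.fac_left]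
    exact eqToIso e₁ ≪≫ Bicategory.whiskerLeftIso j (Bicategory.whiskerRightIso η sq.lift) ≪≫
      eqToIso e₂

theorem isWeakFactorizationSystem_cofibrations [HasBinaryCoproducts C] :
    MorphismProperty.IsWeakFactorizationSystem
      (topologyCofibrations (GrothendieckTopology.trivial C))
      (acyclicTopologyFibrations (GrothendieckTopology.trivial C)) where
  rlp := topologyCofibrations_rlp
  llp := rfl
  hasFactorization := ⟨fun f => by
    obtain ⟨Z, j, p, hjp, hj, hp⟩ := exists_cylinder_factorization f
    exact ⟨⟨Z, j, p, hjp, hj, hp⟩⟩⟩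

theorem PathFactorization.cofibration_j {A B : InternalCategory C} {F : A ⟶ B}
    (d : PathFactorization F) : topologyCofibrations (GrothendieckTopology.trivial C) d.j :=
  topologyCofibrations_of_isColimit d.i d.isColimit

theorem PathFactorization.equivalence_j {A B : InternalCategory C} {F : A ⟶ B}
    (d : PathFactorization F) : topologyEquivalences (GrothendieckTopology.trivial C) d.j :=
  (topologyEquivalences_trivial_iff_isTwoEquivalence _).2 d.isTwoEquivalence_j

/-- Both inclusions lift `f` against `d.q`. If `f` lifts against all fibrations, that lift followed
by `d.π` is a pseudo-inverse of `f`. If `f` is an acyclic cofibration, `d.q` is acyclic, so the lift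
exists and exhibits `f` as a retract of `d.j`. -/
theorem topologyFibrations_llp [HasBinaryCoproducts C]
    [(topologyEquivalences (GrothendieckTopology.trivial C)).HasTwoOutOfThreeProperty] :
    (topologyFibrations (GrothendieckTopology.trivial C)).llp =
      topologyCofibrations (GrothendieckTopology.trivial C) ⊓
        topologyEquivalences (GrothendieckTopology.trivial C) := by
  ext A B f
  obtain ⟨d⟩ := nonempty_pathFactorization f
  constructor
  · intro hf
    refine ⟨MorphismProperty.antitone_llp
      (acyclicTopologyFibrations_le_topologyFibrations _) _ hf, ?_⟩
    have := hf d.q d.fibration_q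
    have sq : CommSq d.j f d.q (𝟙 B) := ⟨by rw [d.fac, Category.comp_id]⟩
    rw [topologyEquivalences_trivial_iff_isTwoEquivalence]
    have e₁ : f ≫ sq.lift ≫ d.π = 𝟙 A := by
      rw [← Category.assoc, sq.fac_left, d.retract]
    have e₂ : (sq.lift ≫ d.π) ≫ f = sq.lift ≫ d.π ≫ f := Category.assoc _ _ _
    exact ⟨sq.lift ≫ d.π, ⟨eqToIso e₁⟩,
      ⟨eqToIso e₂ ≪≫ Bicategory.whiskerLeftIso sq.lift d.α.symm ≪≫ eqToIso sq.fac_right⟩⟩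
  · rintro ⟨hf, hW⟩
    -- Here the 2-out-of-3 property is applied to `d.j ≫ d.q = f`.
    have hq : topologyEquivalences (GrothendieckTopology.trivial C) d.q :=
      MorphismProperty.of_precomp _ d.j d.q d.equivalence_j (by rwa [d.fac])
    have := hf d.q ⟨d.fibration_q, hq⟩
    have sq : CommSq d.j f d.q (𝟙 B) := ⟨by rw [d.fac, Category.comp_id]⟩
    have r : RetractArrow f d.j :=
      { i := Arrow.homMk (𝟙 A) sq.lift (by simp)
        r := Arrow.homMk (𝟙 A) d.q (by simp [d.fac])
        retract := by
          ext
          · exact Category.id_comp _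
          · exact sq.fac_right }
    exact MorphismProperty.of_retract r d.j_mem_llp

/-- `f` is a retract of `q` over `B`: isomorphisms are lifted in `Z` with target in the image of
`j`, then pushed into `A` by `l`. -/
theorem topologyFibrations_of_retract {A B Z : InternalCategory C} {f : A ⟶ B} {j : A ⟶ Z}
    {q : Z ⟶ B} {l : Z ⟶ A} (h₁ : j ≫ q = f) (h₂ : j ≫ l = 𝟙 A) (h₃ : l ≫ f = q)
    (hq : topologyFibrations (GrothendieckTopology.trivial C) q) :
    topologyFibrations (GrothendieckTopology.trivial C) f := by
  rw [topologyFibrations_trivial_iff] at hq ⊢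
  intro X a φ φ' h ht
  obtain ⟨θ, θ', hθ, ht', hF⟩ := hq (a ≫ j.obj) h (by
    rw [ht, Category.assoc, ← h₁, comp_obj])
  refine ⟨_, _, hθ.map l, ?_, ?_⟩
  · rw [Category.assoc, l.arr_tgt, reassoc_of% ht', ← comp_obj, h₂, id_obj, Category.comp_id]
  · rw [Category.assoc, ← comp_arr', h₃, hF]

theorem isWeakFactorizationSystem_fibrations [HasBinaryCoproducts C]
    [(topologyEquivalences (GrothendieckTopology.trivial C)).HasTwoOutOfThreeProperty] :
    MorphismProperty.IsWeakFactorizationSystem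
      (topologyCofibrations (GrothendieckTopology.trivial C) ⊓
        topologyEquivalences (GrothendieckTopology.trivial C))
      (topologyFibrations (GrothendieckTopology.trivial C)) where
  rlp := by
    refine le_antisymm ?_ ((MorphismProperty.le_llp_iff_le_rlp _ _).1 topologyFibrations_llp.ge)
    intro A B f hf
    obtain ⟨d⟩ := nonempty_pathFactorization f
    have := hf d.j ⟨d.cofibration_j, d.equivalence_j⟩
    have sq : CommSq (𝟙 A) d.j f d.q := ⟨by rw [d.fac, Category.id_comp]⟩
    exact topologyFibrations_of_retract d.fac sq.fac_left sq.fac_right d.fibration_q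
  llp := topologyFibrations_llp
  hasFactorization := ⟨fun f => by
    obtain ⟨d⟩ := nonempty_pathFactorization f
    exact ⟨⟨d.Z, d.j, d.q, d.fac, ⟨d.cofibration_j, d.equivalence_j⟩, d.fibration_q⟩⟩⟩

/-- Every internal category is fibrant for the trivial topology. -/
theorem topologyFibrations_of_isTerminal {A T : InternalCategory C} (hT : IsTerminal T)
    (F : A ⟶ T) : topologyFibrations (GrothendieckTopology.trivial C) F := by
  rw [topologyFibrations_trivial_iff]
  intro X a φ φ' h ht
  refine ⟨_, _, IsInverse.ident A a, by rw [Category.assoc, A.ident_tgt, Category.comp_id], ?_⟩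
  -- The terminal `T` is a retract of the discrete category on `⊤_ C`, whose object of arrows is
  -- terminal, so any two parallel maps into `T.arr` agree.
  let D := discrete (⊤_ C)
  let t : T ⟶ D := InternalFunctor.mk (B := D) (terminal.from _) (terminal.from _)
    (terminal.hom_ext _ _) (terminal.hom_ext _ _) (terminal.hom_ext _ _) (terminal.hom_ext _ _)
  have e : t ≫ hT.from D = 𝟙 T := hT.hom_ext _ _
  have e' : t.arr ≫ (hT.from D).arr = 𝟙 T.arr := congrArg InternalFunctor.arr e
  rw [← Category.comp_id φ, ← Category.comp_id ((a ≫ A.ident) ≫ F.arr), ← e', ← Category.assoc,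
    ← Category.assoc φ]
  congr 1
  exact terminal.hom_ext _ _

/-- Every internal category is cofibrant for the trivial topology. -/
theorem topologyCofibrations_of_isInitial {A I : InternalCategory C} (hI : IsInitial I)
    (F : I ⟶ A) : topologyCofibrations (GrothendieckTopology.trivial C) F := by
  intro X Y p hp
  obtain ⟨G, hG, -⟩ := (acyclicTopologyFibrations_trivial_iff p).1 hp
  exact ⟨fun {f g} _ => ⟨⟨⟨g ≫ G, hI.hom_ext _ _, by rw [Category.assoc, hG, Category.comp_id]⟩⟩⟩⟩

theorem topologyCofibrations_trivial_eq :
    topologyCofibrations (GrothendieckTopology.trivial C) =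
      trivialModelCofibrations (InternalCategory C) := by
  rw [topologyCofibrations, trivialModelCofibrations, acyclicTopologyFibrations,
    topologyFibrations_trivial_eq, topologyEquivalences_trivial_eq]

end InternalCategory

-- Assembly of the model structure

theorem mainTheorem9 {C : Type u} [Category.{v} C] [HasFiniteLimits C]
    [HasFiniteLimits (InternalCategory C)] [HasFiniteColimits (InternalCategory C)] :
    -- the epimorphisms for the trivial topology are the split epimorphisms
    (∀ {E B : C} (p : E ⟶ B),
      topologyEpis (GrothendieckTopology.trivial C) p ↔ ∃ q : B ⟶ E, q ≫ p = 𝟙 B) ∧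
    -- acyclic fibrations
    (∀ {A B : InternalCategory C} (F : A ⟶ B),
      acyclicTopologyFibrations (GrothendieckTopology.trivial C) F ↔
        ∃ G : B ⟶ A, G ≫ F = 𝟙 B ∧ Nonempty (F ≫ G ≅ 𝟙 A)) ∧
    -- projectives
    (∀ P : C, IsTopologyProjective (GrothendieckTopology.trivial C) P) ∧
    EnoughTopologyProjectives (GrothendieckTopology.trivial C) ∧
    -- the model structure
    ((topologyEquivalences (GrothendieckTopology.trivial C)).HasTwoOutOfThreeProperty →
      (∃ _ : HomotopicalAlgebra.ModelCategory (InternalCategory C),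
        HomotopicalAlgebra.weakEquivalences (InternalCategory C) =
          topologyEquivalences (GrothendieckTopology.trivial C) ∧
        HomotopicalAlgebra.fibrations (InternalCategory C) =
          topologyFibrations (GrothendieckTopology.trivial C) ∧
        HomotopicalAlgebra.cofibrations (InternalCategory C) =
          topologyCofibrations (GrothendieckTopology.trivial C) ∧
        -- every object is fibrant and cofibrant
        (∀ A : InternalCategory C,
          HomotopicalAlgebra.IsFibrant A ∧ HomotopicalAlgebra.IsCofibrant A) ∧
        -- the weak equivalences are the equivalences in the 2-category
        (∀ {A B : InternalCategory C} (F : A ⟶ B),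
          HomotopicalAlgebra.WeakEquivalence F ↔ IsTwoEquivalence F) ∧
        -- the model structure is the trivial one of the 2-category
        HomotopicalAlgebra.weakEquivalences (InternalCategory C) =
          trivialModelWeakEquivalences (InternalCategory C) ∧
        HomotopicalAlgebra.fibrations (InternalCategory C) =
          trivialModelFibrations (InternalCategory C) ∧
        HomotopicalAlgebra.cofibrations (InternalCategory C) =
          trivialModelCofibrations (InternalCategory C))) := by
  refine ⟨fun p => topologyEpis_trivial_iff p,
    fun F => InternalCategory.acyclicTopologyFibrations_trivial_iff F,
    isTopologyProjective_trivial, enoughTopologyProjectives_trivial, fun h => ?_⟩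
  have := InternalCategory.hasBinaryCoproducts (C := C)
  let _ : HomotopicalAlgebra.CategoryWithFibrations (InternalCategory C) :=
    ⟨topologyFibrations (GrothendieckTopology.trivial C)⟩
  let _ : HomotopicalAlgebra.CategoryWithCofibrations (InternalCategory C) :=
    ⟨topologyCofibrations (GrothendieckTopology.trivial C)⟩
  let _ : HomotopicalAlgebra.CategoryWithWeakEquivalences (InternalCategory C) :=
    ⟨topologyEquivalences (GrothendieckTopology.trivial C)⟩
  have : (HomotopicalAlgebra.weakEquivalences (InternalCategory C)).HasTwoOutOfThreeProperty := h
  have : MorphismProperty.IsWeakFactorizationSystem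
      (HomotopicalAlgebra.cofibrations (InternalCategory C))
      (HomotopicalAlgebra.trivialFibrations (InternalCategory C)) :=
    InternalCategory.isWeakFactorizationSystem_cofibrations
  have : MorphismProperty.IsWeakFactorizationSystem
      (HomotopicalAlgebra.trivialCofibrations (InternalCategory C))
      (HomotopicalAlgebra.fibrations (InternalCategory C)) :=
    InternalCategory.isWeakFactorizationSystem_fibrations
  -- The three classes are those installed by the local instances, so their identifications hold by
  -- definition.
  refine ⟨HomotopicalAlgebra.ModelCategory.mk' _, rfl, rfl, rfl, fun A => ⟨?_, ?_⟩,
    fun {A B} F => ?_, InternalCategory.topologyEquivalences_trivial_eq,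
    InternalCategory.topologyFibrations_trivial_eq,
    InternalCategory.topologyCofibrations_trivial_eq⟩
  · exact ⟨InternalCategory.topologyFibrations_of_isTerminal terminalIsTerminal _⟩
  · exact ⟨InternalCategory.topologyCofibrations_of_isInitial initialIsInitial _⟩
  · exact (HomotopicalAlgebra.weakEquivalence_iff F).trans
      (InternalCategory.topologyEquivalences_trivial_iff_isTwoEquivalence F)
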